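/- Let $R$ and $S$ be associative rings with unit and let ${}_R\omega_S$ be a semidualizing $(R,S)$-bimodule, i.e. an $(R,S)$-bimodule such that: ${}_R\omega$ and $\omega_S$ each admit a projective resolution all of whose terms are finitely generated; the homothety maps $R\to\mathrm{Hom}_{S^{op}}(\omega,\omega)$, $r\mapsto(x\mapsto rx)$, and $S\to\mathrm{Hom}_R(\omega,\omega)$, $s\mapsto(x\mapsto xs)$, are bijective; and $\mathrm{Ext}^i_R(\omega,\omega)=0=\mathrm{Ext}^i_{S^{op}}(\omega,\omega)$ for all $i\ge1$. Here $\mathrm{Tor}^S_i(\omega,N)$ is regarded as a left $R$-module and $\mathrm{Ext}^i_R(\omega,M)$ as a left $S$-module through the bimodule structure of $\omega$. For a left $R$-module $M$ put $\mathrm{E\text{-}cograde}_\omega M=\inf\{i\ge0\mid\mathrm{Ext}^i_R(\omega,M)\ne0\}$, and say that the strong Ext-cograde of $M$ is at least $m$, written $\mathrm{s.E\text{-}cograde}_\omega M\ge m$, if $\mathrm{E\text{-}cograde}_\omega X\ge m$ for every quotient module $X$ of $M$. For a left $S$-module $N$ put $\mathrm{T\text{-}cograde}_\omega N=\inf\{i\ge0\mid\mathrm{Tor}_i^S(\omega,N)\ne0\}$,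 and say that the strong Tor-cograde of $N$ is at least $m$, written $\mathrm{s.T\text{-}cograde}_\omega N\ge m$, if $\mathrm{T\text{-}cograde}_\omega Y\ge m$ for every submodule $Y$ of $N$. (The infimum of the empty set is $\infty$.) Then for every $n\ge1$ the following statements are equivalent. (1) $\mathrm{s.E\text{-}cograde}_\omega\,\mathrm{Tor}_i^S(\omega,N)\ge i$ for every left $S$-module $N$ and every $1\le i\le n$. (2) $\mathrm{s.T\text{-}cograde}_\omega\,\mathrm{Ext}^i_R(\omega,M)\ge i$ for every left $R$-module $M$ and every $1\le i\le n$. -/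

import Mathlib

open CategoryTheory CategoryTheory.Abelian
open scoped TensorProduct

universe u

/- Throughout, `ω` is an `(R, S)`-bimodule: a left `R`-module and a right `S`-module (that is, a
left `Sᵐᵒᵖ`-module) whose two actions commute. -/

section Tensor

variable (R S ω : Type u) [Ring R] [Ring S] [AddCommGroup ω] [Module R ω] [Module Sᵐᵒᵖ ω]

/-- The relations `(x s) ⊗ y = x ⊗ (s y)` inside `ω ⊗_ℤ N`. When the actions of `R` and `S` on `ω`
commute, the set of generators is stable under `R`, so that this `R`-submodule is the subgroup
generated by them. -/
def balancedRel (N : Type u) [AddCommGroup N] [Module S N] : Submodule R (ω ⊗[ℤ] N) :=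
  Submodule.span R
    {t | ∃ (x : ω) (s : S) (y : N), t = (MulOpposite.op s • x) ⊗ₜ[ℤ] y - x ⊗ₜ[ℤ] (s • y)}

/-- The tensor product `ω ⊗_S N` over the (not necessarily commutative) ring `S`, as a left
`R`-module. -/
abbrev BalancedTensor (N : Type u) [AddCommGroup N] [Module S N] : Type u :=
  (ω ⊗[ℤ] N) ⧸ balancedRel R S ω N

/-- The map `ω ⊗_S f`, sending the class of `x ⊗ y` to the class of `x ⊗ f y`. -/
def balancedMap {N N' : Type u} [AddCommGroup N] [Module S N] [AddCommGroup N'] [Module S N']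
    (f : N →ₗ[S] N') : BalancedTensor R S ω N →ₗ[R] BalancedTensor R S ω N' :=
  Submodule.mapQ _ _
    (TensorProduct.AlgebraTensorModule.map (LinearMap.id : ω →ₗ[R] ω)
      f.toAddMonoidHom.toIntLinearMap) (by
    rw [balancedRel, Submodule.span_le]
    rintro _ ⟨x, s, y, rfl⟩
    refine Submodule.subset_span ⟨x, s, f y, ?_⟩
    simp)

theorem balancedMap_mk_tmul {N N' : Type u} [AddCommGroup N] [Module S N] [AddCommGroup N']
    [Module S N'] (f : N →ₗ[S] N') (x : ω) (y : N) :
    balancedMap R S ω f ((balancedRel R S ω N).mkQ (x ⊗ₜ[ℤ] y)) =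
      (balancedRel R S ω N').mkQ (x ⊗ₜ[ℤ] f y) := rfl

theorem balancedTensor_hom_ext {N : Type u} [AddCommGroup N] [Module S N] {P : Type u}
    [AddCommGroup P] [Module R P] {f g : BalancedTensor R S ω N →ₗ[R] P}
    (h : ∀ (x : ω) (y : N), f ((balancedRel R S ω N).mkQ (x ⊗ₜ[ℤ] y)) =
      g ((balancedRel R S ω N).mkQ (x ⊗ₜ[ℤ] y))) : f = g := by
  refine Submodule.linearMap_qext _ ?_
  ext x y
  exact h x y

/-- The functor `ω ⊗_S -` from left `S`-modules to left `R`-modules. -/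
def tensorFunctor : ModuleCat.{u} S ⥤ ModuleCat.{u} R where
  obj N := ModuleCat.of R (BalancedTensor R S ω N)
  map f := ModuleCat.ofHom (balancedMap R S ω f.hom)
  map_id N := by
    apply ModuleCat.hom_ext
    exact balancedTensor_hom_ext R S ω fun x y => rfl
  map_comp f g := by
    apply ModuleCat.hom_ext
    exact balancedTensor_hom_ext R S ω fun x y => rfl

instance tensorFunctor_additive : (tensorFunctor R S ω).Additive where
  map_add {N N' f g} := by
    apply ModuleCat.hom_ext
    refine balancedTensor_hom_ext R S ω fun x y => ?_
    change (balancedRel R S ω N').mkQ (x ⊗ₜ[ℤ] (f.hom y + g.hom y)) =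
      (balancedRel R S ω N').mkQ (x ⊗ₜ[ℤ] f.hom y) + (balancedRel R S ω N').mkQ (x ⊗ₜ[ℤ] g.hom y)
    rw [TensorProduct.tmul_add, map_add]

/-- `Tor_i^S(ω, N)`, as a left `R`-module. -/
noncomputable def torObj (i : ℕ) (N : ModuleCat.{u} S) : ModuleCat.{u} R :=
  ((tensorFunctor R S ω).leftDerived i).obj N

end Tensor

section Ext

variable (R S ω : Type u) [Ring R] [Ring S] [AddCommGroup ω] [Module R ω] [Module Sᵐᵒᵖ ω]
  [SMulCommClass R Sᵐᵒᵖ ω]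

/-- Right multiplication `x ↦ x s` by `s : S`, an `R`-linear endomorphism of `ω`. -/
def rightMul (s : S) : ModuleCat.of R ω ⟶ ModuleCat.of R ω :=
  ModuleCat.ofHom
    { toFun := fun x => MulOpposite.op s • x
      map_add' := smul_add _
      map_smul' := fun r x => (smul_comm r (MulOpposite.op s) x).symm }

/-- The left `S`-module structure on `Ext^i_R(ω, M)` induced by the right `S`-module structure on
`ω`: the element `s` acts by the map that right multiplication by `s` on `ω` induces. In degree `0`
this is `(s f)(x) = f (x s)`. -/
@[reducible] noncomputable def extModule (i : ℕ) (M : ModuleCat.{u} R) :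
    Module S (Ext.{u} (ModuleCat.of R ω) M i) where
  smul s e := (Ext.mk₀ (rightMul R S ω s)).comp e (zero_add i)
  one_smul e := by
    have h : rightMul R S ω 1 = 𝟙 _ := by
      ext x
      exact one_smul Sᵐᵒᵖ x
    change (Ext.mk₀ (rightMul R S ω 1)).comp e (zero_add i) = e
    rw [h, Ext.mk₀_id_comp]
  mul_smul s t e := by
    have h : rightMul R S ω (s * t) = rightMul R S ω s ≫ rightMul R S ω t := by
      ext x
      exact mul_smul (MulOpposite.op t) (MulOpposite.op s) x
    change (Ext.mk₀ (rightMul R S ω (s * t))).comp e (zero_add i) =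
      (Ext.mk₀ (rightMul R S ω s)).comp ((Ext.mk₀ (rightMul R S ω t)).comp e (zero_add i))
        (zero_add i)
    rw [h, Ext.mk₀_comp_mk₀_assoc]
  smul_zero s := Ext.comp_zero (Ext.mk₀ (rightMul R S ω s)) M i i (zero_add i)
  smul_add s e e' := Ext.comp_add _ _ _ _
  add_smul s t e := by
    have h : rightMul R S ω (s + t) = rightMul R S ω s + rightMul R S ω t := by
      ext x
      exact add_smul (MulOpposite.op s) (MulOpposite.op t) x
    change (Ext.mk₀ (rightMul R S ω (s + t))).comp e (zero_add i) =
      (Ext.mk₀ (rightMul R S ω s)).comp e (zero_add i) +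
        (Ext.mk₀ (rightMul R S ω t)).comp e (zero_add i)
    rw [h, Ext.mk₀_add, Ext.add_comp]
  zero_smul e := by
    have h : rightMul R S ω 0 = 0 := by
      ext x
      exact zero_smul Sᵐᵒᵖ x
    change (Ext.mk₀ (rightMul R S ω 0)).comp e (zero_add i) = 0
    rw [h, Ext.mk₀_zero, Ext.zero_comp]

/-- `Ext^i_R(ω, M)`, as a left `S`-module. -/
noncomputable def extObj (i : ℕ) (M : ModuleCat.{u} R) : ModuleCat.{u} S :=
  letI := extModule R S ω i M
  ModuleCat.of S (Ext.{u} (ModuleCat.of R ω) M i)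

end Ext

section Semidualizing

/-- `M` has a degreewise finite projective resolution: an exact sequence
`⋯ → P₁ → P₀ → M → 0` with all `Pₖ` finitely generated projective. -/
def HasDegreewiseFiniteResolution (A M : Type u) [Ring A] [AddCommGroup M] [Module A M] : Prop :=
  ∃ P : ProjectiveResolution (ModuleCat.of A M), ∀ k : ℕ, Module.Finite A (P.complex.X k)

/-- The `(R, S)`-bimodule `ω` is semidualizing. -/
structure IsSemidualizing (R S ω : Type u) [Ring R] [Ring S] [AddCommGroup ω] [Module R ω]
    [Module Sᵐᵒᵖ ω] [SMulCommClass R Sᵐᵒᵖ ω] : Prop where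
  finite_left : HasDegreewiseFiniteResolution R ω
  finite_right : HasDegreewiseFiniteResolution Sᵐᵒᵖ ω
  /-- The homothety map `R → Hom_{Sᵐᵒᵖ}(ω, ω)`, `r ↦ (x ↦ r x)`, is bijective. -/
  homothety_left : Function.Bijective
    (fun r : R => (Module.toModuleEnd Sᵐᵒᵖ ω r : ω →ₗ[Sᵐᵒᵖ] ω))
  /-- The homothety map `S → Hom_R(ω, ω)`, `s ↦ (x ↦ x s)`, is bijective. -/
  homothety_right : Function.Bijective
    (fun s : S => ((rightMul R S ω s).hom : ω →ₗ[R] ω))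
  ext_left : ∀ i : ℕ, 1 ≤ i →
    Subsingleton (Ext.{u} (ModuleCat.of R ω) (ModuleCat.of R ω) i)
  ext_right : ∀ i : ℕ, 1 ≤ i →
    Subsingleton (Ext.{u} (ModuleCat.of Sᵐᵒᵖ ω) (ModuleCat.of Sᵐᵒᵖ ω) i)

end Semidualizing

section Cograde

/-- The Ext-cograde `inf {i ≥ 0 | Ext^i_R(ω, M) ≠ 0}` of `M` with respect to `ω`, which is `⊤` if
there is no such `i`. -/
noncomputable def extCograde (R ω : Type u) [Ring R] [AddCommGroup ω] [Module R ω]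
    (M : ModuleCat.{u} R) : ℕ∞ :=
  ⨅ (i : ℕ) (_ : Nontrivial (Ext.{u} (ModuleCat.of R ω) M i)), (i : ℕ∞)

/-- The Tor-cograde `inf {i ≥ 0 | Tor_i^S(ω, N) ≠ 0}` of `N` with respect to `ω`, which is `⊤` if
there is no such `i`. -/
noncomputable def torCograde (R S ω : Type u) [Ring R] [Ring S] [AddCommGroup ω] [Module R ω]
    [Module Sᵐᵒᵖ ω] (N : ModuleCat.{u} S) : ℕ∞ :=
  ⨅ (i : ℕ) (_ : Nontrivial (torObj R S ω i N)), (i : ℕ∞)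

/-- The strong Ext-cograde of `M` with respect to `ω` is at least `n`: every quotient module of `M`
has Ext-cograde at least `n`. -/
def StrongExtCogradeGE (R ω : Type u) [Ring R] [AddCommGroup ω] [Module R ω]
    (M : ModuleCat.{u} R) (n : ℕ) : Prop :=
  ∀ K : Submodule R M, (n : ℕ∞) ≤ extCograde R ω (ModuleCat.of R (M ⧸ K))

/-- The strong Tor-cograde of `N` with respect to `ω` is at least `n`: every submodule of `N` has
Tor-cograde at least `n`. -/
def StrongTorCogradeGE (R S ω : Type u) [Ring R] [Ring S] [AddCommGroup ω] [Module R ω]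
    [Module Sᵐᵒᵖ ω] (N : ModuleCat.{u} S) (n : ℕ) : Prop :=
  ∀ Y : Submodule S N, (n : ℕ∞) ≤ torCograde R S ω (ModuleCat.of S Y)

end Cograde

/-! Write `F` for `ω ⊗_S -` and `G` for `Hom_R(ω, -)`, so that `F ⊣ G`, and let `L i` and `R i`
stand for Tor and Ext. Semidualizing enters only through four facts: the counit is an isomorphism on
injectives, the unit is an isomorphism on projectives, `G I` is Tor-acyclic for injective `I`, and
`F P` is Ext-acyclic for projective `P`. This package is self-dual under passage to opposite
categories, which exchanges the two statements of the theorem. Hence one implication in abstract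
abelian categories suffices (`cograde_symmetry`).

For that implication, let `Y` be a subobject of `R (m + 1) M`. By dimension shifting, `Y` embeds
into `R m` of a cosyzygy when `m ≥ 1`, so induction gives `L j Y = 0` for `j < m`; only `L m Y`
remains. Two lemmas settle it. `exists_epi_of_mono`: `L m Y` is a quotient of `L (m + 1) C` for some
`C`. With `X` the `m`-th cosyzygy of `M`, `Y` lies in `R 1 X`, which is a quotient of `G (cosyzygy
X)`; the preimage of `Y` embeds in some `G I`, and `C` is the cokernel. The hypothesis then gives `R
j (L m Y) = 0` for `j ≤ m`. `isZero_of_isZero_right`: if `L j Y = 0` for `j < m` and `R j (L m Y) =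
0` for `j ≤ m`, then `L m Y = 0`, because the identity of `L m Y` is zero. This compares `Ext(F P,
X)` with `Hom(P, R j X)` along a projective resolution of `Y`.

The rest supplies the inputs: long exact sequences for Tor and Ext, compatible with the module
structures, and the four facts above. The facts on projectives come from splitting maps `K → ω ⊗ P`,
with `K` finitely generated, into finite sums of maps through `ω`; those on injectives come from the
evaluation `W ⊗ Hom_R(ω, I) → Hom_R(Hom(W, ω), I)`, bijective for finitely presented `W`. -/

open CategoryTheory.Limits (IsZero)

/-! ### Exactness of composable pairs in abelian categories. -/

section ExactPair

variable {C : Type*} [Category* C] [Abelian C]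

/-- Exactness of `X ⟶ Y ⟶ Z` at `Y`, including the vanishing of the composite. -/
def ExactPair {X Y Z : C} (f : X ⟶ Y) (g : Y ⟶ Z) : Prop :=
  ∃ w : f ≫ g = 0, (ShortComplex.mk f g w).Exact

namespace ExactPair

variable {X Y Z : C} {f : X ⟶ Y} {g : Y ⟶ Z}

theorem of_exact {S : ShortComplex C} (h : S.Exact) : ExactPair S.f S.g := ⟨S.zero, h⟩

theorem of_shortExact {S : ShortComplex C} (h : S.ShortExact) : ExactPair S.f S.g :=
  of_exact h.exact

theorem w (h : ExactPair f g) : f ≫ g = 0 := h.1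

theorem mono (h : ExactPair f g) (hX : IsZero X) : Mono g :=
  h.2.mono_g (hX.eq_of_src _ _)

theorem epi (h : ExactPair f g) (hZ : IsZero Z) : Epi f :=
  h.2.epi_f (hZ.eq_of_tgt _ _)

theorem epi_of_eq_zero (h : ExactPair f g) (hg : g = 0) : Epi f := h.2.epi_f hg

theorem isZero (h : ExactPair f g) (hX : IsZero X) (hZ : IsZero Z) : IsZero Y := by
  have := h.mono hX
  exact hZ.of_mono g

theorem eq_zero_of_mono (h : ExactPair f g) [Mono g] : f = 0 := by
  rw [← cancel_mono g, h.w, Limits.zero_comp]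

theorem isIso {W V : C} {e : W ⟶ X} {k : Y ⟶ V} (h : ExactPair e f) (h' : ExactPair f k)
    (hW : IsZero W) (hV : IsZero V) : IsIso f := by
  have := h.mono hW
  have := h'.epi hV
  exact isIso_of_mono_of_epi f

theorem exists_desc (h : ExactPair f g) [Epi g] {V : C} (k : Y ⟶ V) (hk : f ≫ k = 0) :
    ∃ t : Z ⟶ V, g ≫ t = k := by
  have : Epi (ShortComplex.mk f g h.1).g := ‹_›
  exact ⟨h.2.desc k hk, h.2.g_desc k hk⟩

theorem exists_lift (h : ExactPair f g) [Mono f] {V : C} (k : V ⟶ Y) (hk : k ≫ g = 0) :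
    ∃ t : V ⟶ X, t ≫ f = k := by
  have : Mono (ShortComplex.mk f g h.1).f := ‹_›
  exact ⟨h.2.lift k hk, h.2.lift_f k hk⟩

theorem comp_mono_iff {V : C} (i : Z ⟶ V) [Mono i] : ExactPair f (g ≫ i) ↔ ExactPair f g := by
  constructor
  · rintro ⟨w, h⟩
    have w' : f ≫ g = 0 := by rw [← cancel_mono i]; simpa using w
    refine ⟨w', ?_⟩
    rw [ShortComplex.exact_iff_exact_up_to_refinements] at h ⊢
    intro A x hx
    exact h x (by simp only at hx ⊢; rw [reassoc_of% hx, Limits.zero_comp])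
  · rintro ⟨w, h⟩
    refine ⟨by rw [reassoc_of% w, Limits.zero_comp], ?_⟩
    rw [ShortComplex.exact_iff_exact_up_to_refinements] at h ⊢
    intro A x hx
    exact h x (by simp only at hx ⊢; rw [← cancel_mono i]; simpa using hx)

theorem epi_comp_iff {V : C} (p : V ⟶ X) [Epi p] : ExactPair (p ≫ f) g ↔ ExactPair f g := by
  constructor
  · rintro ⟨w, h⟩
    have w' : f ≫ g = 0 := by rw [← cancel_epi p]; simpa using w
    refine ⟨w', ?_⟩
    rw [ShortComplex.exact_iff_exact_up_to_refinements] at h ⊢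
    intro A x hx
    obtain ⟨A', π, hπ, y, hy⟩ := h x hx
    exact ⟨A', π, hπ, y ≫ p, by simpa using hy⟩
  · rintro ⟨w, h⟩
    refine ⟨by simp [w], ?_⟩
    rw [ShortComplex.exact_iff_exact_up_to_refinements] at h ⊢
    intro A x hx
    obtain ⟨A', π, hπ, y, hy⟩ := h x hx
    obtain ⟨A'', π', hπ', y', hy'⟩ := surjective_up_to_refinements_of_epi p y
    refine ⟨A'', π' ≫ π, epi_comp _ _, y', ?_⟩
    simp only at hy ⊢
    rw [Category.assoc, hy, reassoc_of% hy']

theorem epi_of_comp_mono {V : C} {t : V ⟶ X} [Mono f] (w : f ≫ g = 0)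
    (h : ExactPair (t ≫ f) g) : Epi t := by
  rw [epi_iff_surjective_up_to_refinements]
  intro A y
  obtain ⟨A', π, hπ, x, hx⟩ := h.2.exact_up_to_refinements (y ≫ f) (by simp [w])
  exact ⟨A', π, hπ, x, by rw [← cancel_mono f]; simpa using hx⟩

theorem op (h : ExactPair f g) : ExactPair g.op f.op :=
  ⟨by rw [← op_comp, h.w]; rfl, h.2.op⟩

theorem shortExact (h : ExactPair f g) [Mono f] [Epi g] :
    (ShortComplex.mk f g h.1).ShortExact where
  exact := h.2
  mono_f := ‹_›
  epi_g := ‹_›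

end ExactPair

end ExactPair

/-! ### Derived families, described by long exact sequences without naturality. -/

section Families

variable {A B : Type*} [Category* A] [Abelian A] [Category* B] [Abelian B]

/-- `L` behaves like the family of left derived functors of `F`: long exact sequences exist and
`L i` vanishes on projectives for `i > 0`. -/
structure IsLeftDerivedFamily (F : A ⥤ B) (L : ℕ → A → B) : Prop where
  zero : ∀ N, Nonempty (L 0 N ≅ F.obj N)
  iso : ∀ (i : ℕ) {N N' : A}, (N ≅ N') → Nonempty (L i N ≅ L i N')
  projective : ∀ (i : ℕ) (P : A), Projective P → IsZero (L (i + 1) P)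
  les_zero : ∀ S : ShortComplex A, S.ShortExact →
    ∃ (a : L 1 S.X₁ ⟶ L 1 S.X₂) (b : L 1 S.X₂ ⟶ L 1 S.X₃) (δ : L 1 S.X₃ ⟶ F.obj S.X₁),
      ExactPair a b ∧ ExactPair b δ ∧ ExactPair δ (F.map S.f)
  les_succ : ∀ (i : ℕ) (S : ShortComplex A), S.ShortExact →
    ∃ (a : L (i + 2) S.X₁ ⟶ L (i + 2) S.X₂) (b : L (i + 2) S.X₂ ⟶ L (i + 2) S.X₃)
      (δ : L (i + 2) S.X₃ ⟶ L (i + 1) S.X₁) (a' : L (i + 1) S.X₁ ⟶ L (i + 1) S.X₂)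
      (b' : L (i + 1) S.X₂ ⟶ L (i + 1) S.X₃),
      ExactPair a b ∧ ExactPair b δ ∧ ExactPair δ a' ∧ ExactPair a' b'

/-- `R` behaves like the family of right derived functors of `G`: long exact sequences exist and
`R i` vanishes on injectives for `i > 0`. -/
structure IsRightDerivedFamily (G : B ⥤ A) (R : ℕ → B → A) : Prop where
  zero : ∀ M, Nonempty (R 0 M ≅ G.obj M)
  iso : ∀ (i : ℕ) {M M' : B}, (M ≅ M') → Nonempty (R i M ≅ R i M')
  injective : ∀ (i : ℕ) (I : B), Injective I → IsZero (R (i + 1) I)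
  les_zero : ∀ S : ShortComplex B, S.ShortExact →
    ∃ (δ : G.obj S.X₃ ⟶ R 1 S.X₁) (a : R 1 S.X₁ ⟶ R 1 S.X₂) (b : R 1 S.X₂ ⟶ R 1 S.X₃),
      ExactPair (G.map S.g) δ ∧ ExactPair δ a ∧ ExactPair a b
  les_succ : ∀ (i : ℕ) (S : ShortComplex B), S.ShortExact →
    ∃ (a : R (i + 1) S.X₁ ⟶ R (i + 1) S.X₂) (b : R (i + 1) S.X₂ ⟶ R (i + 1) S.X₃)
      (δ : R (i + 1) S.X₃ ⟶ R (i + 2) S.X₁) (a' : R (i + 2) S.X₁ ⟶ R (i + 2) S.X₂)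
      (b' : R (i + 2) S.X₂ ⟶ R (i + 2) S.X₃),
      ExactPair a b ∧ ExactPair b δ ∧ ExactPair δ a' ∧ ExactPair a' b'

open Opposite in
theorem IsLeftDerivedFamily.op {F : A ⥤ B} {L : ℕ → A → B} (h : IsLeftDerivedFamily F L) :
    IsRightDerivedFamily F.op (fun i N => op (L i N.unop)) where
  zero N := ⟨(h.zero N.unop).some.symm.op⟩
  iso i _ _ e := ⟨(h.iso i e.unop).some.op⟩
  injective i I hI := (h.projective i I.unop inferInstance).op
  les_zero S hS := by
    obtain ⟨a, b, δ, h₁, h₂, h₃⟩ := h.les_zero S.unop hS.unop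
    exact ⟨δ.op, b.op, a.op, h₃.op, h₂.op, h₁.op⟩
  les_succ i S hS := by
    obtain ⟨a, b, δ, a', b', h₁, h₂, h₃, h₄⟩ := h.les_succ i S.unop hS.unop
    exact ⟨b'.op, a'.op, δ.op, b.op, a.op, h₄.op, h₃.op, h₂.op, h₁.op⟩

open Opposite in
theorem IsRightDerivedFamily.op {G : B ⥤ A} {R : ℕ → B → A} (h : IsRightDerivedFamily G R) :
    IsLeftDerivedFamily G.op (fun i M => op (R i M.unop)) where
  zero N := ⟨(h.zero N.unop).some.symm.op⟩
  iso i _ _ e := ⟨(h.iso i e.unop).some.op⟩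
  projective i I hI := (h.injective i I.unop inferInstance).op
  les_zero S hS := by
    obtain ⟨a, b, δ, h₁, h₂, h₃⟩ := h.les_zero S.unop hS.unop
    exact ⟨δ.op, b.op, a.op, h₃.op, h₂.op, h₁.op⟩
  les_succ i S hS := by
    obtain ⟨a, b, δ, a', b', h₁, h₂, h₃, h₄⟩ := h.les_succ i S.unop hS.unop
    exact ⟨b'.op, a'.op, δ.op, b.op, a.op, h₄.op, h₃.op, h₂.op, h₁.op⟩

end Families

/-! ### Cosyzygies and vanishing of Yoneda-style Ext. -/

section Cosyzygy

variable {B : Type*} [Category* B] [Abelian B] [EnoughInjectives B]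

/-- The cokernel of the chosen embedding of `X` into an injective object. -/
noncomputable abbrev cosyzygy (X : B) : B := Limits.cokernel (Injective.ι X)

/-- The short exact sequence `0 ⟶ X ⟶ I ⟶ cosyzygy X ⟶ 0`. -/
noncomputable abbrev cosyzygySequence (X : B) : ShortComplex B :=
  ShortComplex.mk (Injective.ι X) (Limits.cokernel.π (Injective.ι X)) (Limits.cokernel.condition _)

theorem cosyzygySequence_shortExact (X : B) : (cosyzygySequence X).ShortExact where
  exact := ShortComplex.exact_cokernel _
  mono_f := by dsimp; infer_instance
  epi_g := by dsimp; infer_instance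

/-- The `k`-th cosyzygy of `X`. -/
noncomputable def iteratedCosyzygy : ℕ → B → B
  | 0, X => X
  | k + 1, X => cosyzygy (iteratedCosyzygy k X)

/-- `ExtVanishes j C X` expresses the vanishing of `Ext^j(C, X)` through morphisms into the
iterated cosyzygies of `X`. -/
def ExtVanishes : ℕ → B → B → Prop
  | 0, C, X => ∀ g : C ⟶ X, g = 0
  | j + 1, C, X => ∀ g : C ⟶ cosyzygy (iteratedCosyzygy j X),
      ∃ h, h ≫ Limits.cokernel.π (Injective.ι (iteratedCosyzygy j X)) = g

/-- The hypothesis `H` says `Ext^1(S.X₃, X) = 0`. Extend `g` to a map `e` into the injective hull,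
which induces `d` on the quotients; correcting `e` by a lift of `d` makes it land in `X`. -/
theorem exists_extension_of_lifts {S : ShortComplex B} (hS : S.ShortExact) {X : B}
    (H : ∀ g : S.X₃ ⟶ cosyzygy X, ∃ h, h ≫ Limits.cokernel.π (Injective.ι X) = g)
    (g : S.X₁ ⟶ X) : ∃ k : S.X₂ ⟶ X, S.f ≫ k = g := by
  have := hS.mono_f
  have := hS.epi_g
  set e := Injective.factorThru (g ≫ Injective.ι X) S.f with he
  have he' : S.f ≫ e = g ≫ Injective.ι X := Injective.comp_factorThru _ _
  obtain ⟨d, hd⟩ := (ExactPair.of_shortExact hS).exists_desc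
    (e ≫ Limits.cokernel.π (Injective.ι X)) (by rw [reassoc_of% he']; simp)
  obtain ⟨h, hh⟩ := H d
  obtain ⟨k, hk⟩ := (ExactPair.of_shortExact (cosyzygySequence_shortExact X)).exists_lift
    (e - S.g ≫ h) (by simp [hh, hd])
  refine ⟨k, ?_⟩
  rw [← cancel_mono (Injective.ι X), Category.assoc, hk]
  simp [he']

/-- The piece `Ext^j(X₂) → Ext^j(X₁) → Ext^(j+1)(X₃)` of the contravariant sequence. -/
theorem ExtVanishes.of_shortExact {S : ShortComplex B} (hS : S.ShortExact) {X : B} {j : ℕ}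
    (h₃ : ExtVanishes (j + 1) S.X₃ X) (h₂ : ExtVanishes j S.X₂ X) : ExtVanishes j S.X₁ X := by
  cases j with
  | zero =>
    intro g
    obtain ⟨k, rfl⟩ := exists_extension_of_lifts hS h₃ g
    rw [h₂ k]
    exact Limits.comp_zero
  | succ j =>
    intro g
    obtain ⟨k, rfl⟩ := exists_extension_of_lifts hS h₃ g
    obtain ⟨h, rfl⟩ := h₂ k
    exact ⟨S.f ≫ h, Category.assoc _ _ _⟩

theorem ExtVanishes.of_isZero {C : B} (hC : IsZero C) (X : B) (j : ℕ) : ExtVanishes j C X := by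
  cases j with
  | zero => exact fun g => hC.eq_of_src _ _
  | succ j => exact fun g => ⟨0, hC.eq_of_src _ _⟩

end Cosyzygy

/-! ### Dimension shifting, and the interaction of derived families with the adjunction. -/

section Shift

variable {A B : Type*} [Category* A] [Abelian A] [Category* B] [Abelian B]

theorem IsRightDerivedFamily.nonempty_iso {G : B ⥤ A} {R : ℕ → B → A}
    (hR : IsRightDerivedFamily G R) (i : ℕ) {S : ShortComplex B} (hS : S.ShortExact)
    (h₁ : IsZero (R (i + 1) S.X₂)) (h₂ : IsZero (R (i + 2) S.X₂)) :
    Nonempty (R (i + 1) S.X₃ ≅ R (i + 2) S.X₁) := by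
  obtain ⟨a, b, δ, a', b', e₁, e₂, e₃, e₄⟩ := hR.les_succ i S hS
  have := e₂.isIso e₃ h₁ h₂
  exact ⟨asIso δ⟩

theorem IsLeftDerivedFamily.nonempty_iso {F : A ⥤ B} {L : ℕ → A → B}
    (hL : IsLeftDerivedFamily F L) (i : ℕ) {S : ShortComplex A} (hS : S.ShortExact)
    (h₁ : IsZero (L (i + 1) S.X₂)) (h₂ : IsZero (L (i + 2) S.X₂)) :
    Nonempty (L (i + 2) S.X₃ ≅ L (i + 1) S.X₁) := by
  obtain ⟨a, b, δ, a', b', e₁, e₂, e₃, e₄⟩ := hL.les_succ i S hS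
  have := e₂.isIso e₃ h₂ h₁
  exact ⟨asIso δ⟩

theorem IsRightDerivedFamily.nonempty_iso_cosyzygy [EnoughInjectives B] {G : B ⥤ A}
    {R : ℕ → B → A} (hR : IsRightDerivedFamily G R) (i : ℕ) (X : B) :
    Nonempty (R (i + 1) (cosyzygy X) ≅ R (i + 2) X) :=
  hR.nonempty_iso i (cosyzygySequence_shortExact X) (hR.injective _ _ inferInstance)
    (hR.injective _ _ inferInstance)

theorem IsRightDerivedFamily.nonempty_iso_iteratedCosyzygy [EnoughInjectives B] {G : B ⥤ A}
    {R : ℕ → B → A} (hR : IsRightDerivedFamily G R) (k i : ℕ) (X : B) :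
    Nonempty (R (i + 1) (iteratedCosyzygy k X) ≅ R (k + i + 1) X) := by
  induction k generalizing i with
  | zero => rw [zero_add]; exact ⟨Iso.refl _⟩
  | succ k ih =>
    have e := (hR.nonempty_iso_cosyzygy i (iteratedCosyzygy k X)).some ≪≫ (ih (i + 1)).some
    rw [show k + (i + 1) + 1 = k + 1 + i + 1 by omega] at e
    exact ⟨e⟩

end Shift

section Syzygy

variable {A : Type*} [Category* A] [Abelian A] [EnoughProjectives A]

/-- The chosen projective presentation `0 ⟶ syzygy X ⟶ P ⟶ X ⟶ 0`. -/
noncomputable abbrev syzygySequence (X : A) : ShortComplex A :=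
  ShortComplex.mk (Limits.kernel.ι (Projective.π X)) (Projective.π X) (Limits.kernel.condition _)

theorem syzygySequence_shortExact (X : A) : (syzygySequence X).ShortExact where
  exact := ShortComplex.exact_kernel _
  mono_f := by dsimp; infer_instance
  epi_g := by dsimp; infer_instance

end Syzygy

section Adjunction

variable {A B : Type*} [Category* A] [Abelian A] [Category* B] [Abelian B]
  {F : A ⥤ B} {G : B ⥤ A}

theorem exactPair_map_of_adjunction (adj : F ⊣ G) [F.Additive] {S : ShortComplex A}
    (hS : S.ShortExact) : ExactPair (F.map S.f) (F.map S.g) ∧ Epi (F.map S.g) := by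
  have := adj.leftAdjoint_preservesColimits
  have := hS.epi_g
  exact ⟨⟨_, (hS.exact.map_of_epi_of_preservesCokernel F inferInstance inferInstance)⟩,
    inferInstance⟩

theorem exactPair_map_of_adjunction' (adj : F ⊣ G) [G.Additive] {S : ShortComplex B}
    (hS : S.ShortExact) : ExactPair (G.map S.f) (G.map S.g) ∧ Mono (G.map S.f) := by
  have := adj.rightAdjoint_preservesLimits
  have := hS.mono_f
  exact ⟨⟨_, (hS.exact.map_of_mono_of_preservesKernel G inferInstance inferInstance)⟩,
    inferInstance⟩

/-- Morally `Ext^j(F P, X) = Hom(P, R j X)`. When `R j X = 0`, `G` keeps the last cosyzygy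
projection epi, so a map out of `P` lifts along it and the lift transposes back. -/
theorem extVanishes_obj_projective [EnoughInjectives B] {R : ℕ → B → A} (adj : F ⊣ G) (hR : IsRightDerivedFamily G R) {P : A} [Projective P] {X : B}
    {j : ℕ} (h : IsZero (R j X)) : ExtVanishes j (F.obj P) X := by
  cases j with
  | zero =>
    intro g
    have hG := h.of_iso (hR.zero X).some.symm
    apply (adj.homEquiv _ _).injective
    exact hG.eq_of_tgt _ _
  | succ j =>
    intro g
    obtain ⟨δ, a, b, e₁, e₂, e₃⟩ :=
      hR.les_zero _ (cosyzygySequence_shortExact (iteratedCosyzygy j X))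
    have := e₁.epi (h.of_iso ((hR.nonempty_iso_iteratedCosyzygy j 0 X).some))
    refine ⟨(adj.homEquiv _ _).symm (Projective.factorThru (adj.homEquiv _ _ g)
      (G.map (Limits.cokernel.π (Injective.ι (iteratedCosyzygy j X))))), ?_⟩
    rw [← Adjunction.homEquiv_naturality_right_symm, Projective.factorThru_comp,
      Equiv.symm_apply_apply]

/-- The cokernel of `G X ⟶ G I`, where `X ⟶ I` is the chosen embedding into an injective. -/
noncomputable abbrev imageCosyzygy [EnoughInjectives B] (G : B ⥤ A) (X : B) : A :=
  Limits.cokernel (G.map (Injective.ι X))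

end Adjunction

/-! ### Vanishing of `L m Y` from vanishing of its right derived objects. -/

section Adjoint

variable {A B : Type*} [Category* A] [Abelian A] [Category* B] [Abelian B]
  [EnoughProjectives A] [EnoughInjectives B] {F : A ⥤ B} {G : B ⥤ A}
  {L : ℕ → A → B} {R : ℕ → B → A}

/-- Replacing `Y` by its syzygy `K` lowers `m`: as `L 1 Y = 0`, the sequence `0 → F K → F P → F Y →
0` is exact, so the Ext condition drops one degree. At the bottom `0 → L 1 Y → F K → F P → F Y → 0`
is cut into two short exact sequences, and a map `L 1 Y ⟶ X` extends to `F K`, where it must vanish.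
-/
theorem hom_eq_zero_of_extVanishes (adj : F ⊣ G) [F.Additive] (hL : IsLeftDerivedFamily F L)
    (hR : IsRightDerivedFamily G R) {X : B} (m : ℕ) {Y : A}
    (hY : ∀ j, 1 ≤ j → j ≤ m → IsZero (L j Y)) (hFY : ExtVanishes (m + 2) (F.obj Y) X)
    (hX : ∀ j, j ≤ m + 1 → IsZero (R j X)) (f : L (m + 1) Y ⟶ X) : f = 0 := by
  induction m generalizing Y with
  | zero =>
    have hY' := syzygySequence_shortExact Y
    obtain ⟨a, b, δ, -, e₂, e₃⟩ := hL.les_zero _ hY'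
    obtain ⟨e₄, e₅⟩ := exactPair_map_of_adjunction adj hY'
    have := e₂.mono (hL.projective 0 _ (Projective.projective_over Y))
    -- The kernel of `F P → F Y` is the image of `F K → F P`, the middle term at which the four-term
    -- sequence is cut.
    have h₁ : (ShortComplex.mk (Limits.kernel.ι (F.map (syzygySequence Y).g))
        (F.map (syzygySequence Y).g) (Limits.kernel.condition _)).ShortExact :=
      { exact := ShortComplex.exact_kernel _, mono_f := by dsimp; infer_instance, epi_g := e₅ }
    obtain ⟨t, ht⟩ := ExactPair.exists_lift (ExactPair.of_shortExact h₁)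
      (F.map (syzygySequence Y).f) e₄.w
    have e₆ : ExactPair δ t := by
      rw [← ExactPair.comp_mono_iff (Limits.kernel.ι (F.map (syzygySequence Y).g))]
      rw [← ht] at e₃
      exact e₃
    have : Epi t := by
      rw [← ht] at e₄
      exact ExactPair.epi_of_comp_mono (Limits.kernel.condition _) e₄
    have E₁ := ExtVanishes.of_shortExact h₁ (j := 1) hFY
      (extVanishes_obj_projective adj hR (P := Projective.over Y) (hX 1 (by omega)))
    refine ExtVanishes.of_shortExact e₆.shortExact (j := 0) E₁ (fun g => ?_) f
    -- `F K` is a quotient of some `F P'` with `P'` projective, and `Hom(F P', X) = Hom(P', G X) =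
    -- 0`.
    have := (exactPair_map_of_adjunction adj
      (syzygySequence_shortExact (syzygySequence Y).X₁)).2
    rw [← cancel_epi (F.map (Projective.π (syzygySequence Y).X₁)), Limits.comp_zero]
    exact extVanishes_obj_projective adj hR (j := 0) (hX 0 (by omega)) _
  | succ m ih =>
    have hY' := syzygySequence_shortExact Y
    obtain ⟨a, b, δ, -, e₂, e₃⟩ := hL.les_zero _ hY'
    obtain ⟨e₄, e₅⟩ := exactPair_map_of_adjunction adj hY'
    have := e₃.mono (hY 1 le_rfl (by omega))
    have hP := fun i => hL.projective i (Projective.over Y) inferInstance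
    have E := ExtVanishes.of_shortExact e₄.shortExact hFY
      (extVanishes_obj_projective adj hR (P := Projective.over Y) (hX _ le_rfl))
    have iso := fun i => (hL.nonempty_iso i hY' (hP _) (hP _)).some
    have := ih (Y := (syzygySequence Y).X₁)
      (fun j h₁ h₂ => by
        obtain ⟨j, rfl⟩ := Nat.exists_eq_add_of_le' h₁
        exact (hY (j + 2) (by omega) (by omega)).of_iso (iso j).symm) E
      (fun j hj => hX j (by omega)) ((iso m).inv ≫ f)
    rwa [← cancel_epi (iso m).inv, Limits.comp_zero]

/-- The previous vanishing is applied to `X = L m Y` and its identity; the Ext condition is free for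
`m ≥ 1` because `F Y ≅ L 0 Y = 0`. -/
theorem isZero_of_isZero_right (adj : F ⊣ G) [F.Additive] (hL : IsLeftDerivedFamily F L)
    (hR : IsRightDerivedFamily G R) (m : ℕ) {Y : A} (hY : ∀ j, j < m → IsZero (L j Y))
    (hX : ∀ j, j ≤ m → IsZero (R j (L m Y))) : IsZero (L m Y) := by
  rw [IsZero.iff_id_eq_zero]
  cases m with
  | zero =>
    have hG := (hX 0 le_rfl).of_iso (hR.zero _).some.symm
    rw [← cancel_epi (hL.zero Y).some.inv]
    apply (adj.homEquiv _ _).injective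
    exact hG.eq_of_tgt _ _
  | succ m =>
    refine hom_eq_zero_of_extVanishes adj hL hR m (fun j _ h => hY j (by omega))
      (ExtVanishes.of_isZero ?_ _ _) hX _
    exact (hY 0 (by omega)).of_iso (hL.zero Y).some.symm

end Adjoint

/-! ### Subobjects of `R 1 X`, using the counit on injectives. -/

section InjectiveSide

variable {A B : Type*} [Category* A] [Abelian A] [Category* B] [Abelian B] [EnoughInjectives B]
  {F : A ⥤ B} {G : B ⥤ A} [F.Additive] [G.Additive] {L : ℕ → A → B} {R : ℕ → B → A}

theorem imageCosyzygy_shortExact (adj : F ⊣ G) (X : B) :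
    (ShortComplex.mk (G.map (Injective.ι X)) (Limits.cokernel.π (G.map (Injective.ι X)))
      (Limits.cokernel.condition _)).ShortExact where
  exact := ShortComplex.exact_cokernel _
  mono_f := (exactPair_map_of_adjunction' adj (cosyzygySequence_shortExact X)).2
  epi_g := by dsimp; infer_instance

/-- The inclusion of `imageCosyzygy G X` into `G (cosyzygy X)`. -/
noncomputable def imageCosyzygyι (G : B ⥤ A) [G.Additive] (X : B) :
    imageCosyzygy G X ⟶ G.obj (cosyzygy X) :=
  Limits.cokernel.desc _ (G.map (Limits.cokernel.π (Injective.ι X)))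
    (by rw [← G.map_comp, Limits.cokernel.condition, G.map_zero])

theorem π_imageCosyzygyι (X : B) :
    Limits.cokernel.π (G.map (Injective.ι X)) ≫ imageCosyzygyι G X =
      G.map (Limits.cokernel.π (Injective.ι X)) :=
  Limits.cokernel.π_desc _ _ _

theorem mono_imageCosyzygyι (adj : F ⊣ G) (X : B) : Mono (imageCosyzygyι G X) := by
  have h := (exactPair_map_of_adjunction' adj (cosyzygySequence_shortExact X)).1
  obtain ⟨w, h⟩ := h
  exact h.mono_cokernelDesc

theorem exists_imageCosyzygy_shortExact (adj : F ⊣ G) (hR : IsRightDerivedFamily G R) (X : B) :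
    ∃ (q : G.obj (cosyzygy X) ⟶ R 1 X) (w : imageCosyzygyι G X ≫ q = 0),
      (ShortComplex.mk (imageCosyzygyι G X) q w).ShortExact := by
  obtain ⟨δ, a, b, e₁, e₂, -⟩ := hR.les_zero _ (cosyzygySequence_shortExact X)
  have := e₂.epi (hR.injective 0 (Injective.under X) inferInstance)
  have := mono_imageCosyzygyι adj X
  dsimp at e₁
  rw [← π_imageCosyzygyι, ExactPair.epi_comp_iff] at e₁
  exact ⟨δ, e₁.w, e₁.shortExact⟩

/-- A cosyzygy is a quotient of an injective, where the counit is invertible. -/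
theorem epi_counit_cosyzygy (adj : F ⊣ G)
    (hI : ∀ I : B, Injective I → IsIso (adj.counit.app I)) (X : B) :
    Epi (adj.counit.app (cosyzygy X)) := by
  have := hI (Injective.under X) inferInstance
  have h := adj.counit.naturality (Limits.cokernel.π (Injective.ι X))
  have : Epi ((G ⋙ F).map (Limits.cokernel.π (Injective.ι X)) ≫ adj.counit.app _) := by
    rw [h]
    exact epi_comp _ _
  exact epi_of_epi (((G ⋙ F).map (Limits.cokernel.π (Injective.ι X)))) _

/-- Right exactness presents `F (imageCosyzygy G X)` as the cokernel of `F G X → F G I`. Since `F G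
I ≅ I` and `F G X → X` is epi, this is the cokernel of `X → I`. -/
theorem isIso_map_imageCosyzygyι_comp_counit (adj : F ⊣ G)
    (hI : ∀ I : B, Injective I → IsIso (adj.counit.app I)) (X : B) [Epi (adj.counit.app X)] :
    IsIso (F.map (imageCosyzygyι G X) ≫ adj.counit.app (cosyzygy X)) := by
  have := hI (Injective.under X) inferInstance
  have := (exactPair_map_of_adjunction adj (imageCosyzygy_shortExact adj X)).2
  set p := F.map (Limits.cokernel.π (G.map (Injective.ι X))) with hp
  set ψ := F.map (imageCosyzygyι G X) ≫ adj.counit.app (cosyzygy X) with hψ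
  have h₁ : p ≫ ψ = adj.counit.app (Injective.under X) ≫ Limits.cokernel.π (Injective.ι X) := by
    rw [hp, hψ, ← F.map_comp_assoc, π_imageCosyzygyι]
    exact adj.counit.naturality _
  obtain ⟨s, hs⟩ := (ExactPair.of_shortExact (cosyzygySequence_shortExact X)).exists_desc
    (inv (adj.counit.app (Injective.under X)) ≫ p) (by
      rw [← cancel_epi (adj.counit.app X)]
      have := adj.counit.naturality_assoc (Injective.ι X)
        (inv (adj.counit.app (Injective.under X)) ≫ p)
      dsimp at this ⊢
      rw [← this, IsIso.hom_inv_id_assoc, hp, ← F.map_comp, Limits.cokernel.condition,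
        F.map_zero, Limits.comp_zero])
  dsimp at hs
  refine ⟨s, ?_, ?_⟩
  · rw [← cancel_epi p, reassoc_of% h₁, hs, IsIso.hom_inv_id_assoc, Category.comp_id]
  · rw [← cancel_epi (Limits.cokernel.π (Injective.ι X)), reassoc_of% hs, h₁]
    simp

/-- Induction alternates two sequences. From `0 → imageCosyzygy G X → G (cosyzygy X) → R 1 X → 0`,
with `R 1 X` a higher `R i M`, acyclicity passes to `G (cosyzygy X)`; from `0 → G X' → G I →
imageCosyzygy G X' → 0` with `X' = cosyzygy X` it passes on one degree up. In the base case the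
first sequence shows that the counit is an isomorphism at the second cosyzygy. -/
theorem isZero_imageCosyzygy (adj : F ⊣ G) (hL : IsLeftDerivedFamily F L)
    (hR : IsRightDerivedFamily G R) (hI : ∀ I : B, Injective I → IsIso (adj.counit.app I))
    (hLI : ∀ (i : ℕ) (I : B), Injective I → IsZero (L (i + 1) (G.obj I))) (m : ℕ)
    (H : ∀ i, 2 ≤ i → i ≤ m + 2 → ∀ (M : B) j, j < i → IsZero (L j (R i M))) (M : B) :
    IsZero (L (m + 1) (imageCosyzygy G (iteratedCosyzygy (m + 2) M))) := by
  induction m with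
  | zero =>
    change IsZero (L 1 (imageCosyzygy G (cosyzygy (cosyzygy M))))
    obtain ⟨q, w, hq⟩ := exists_imageCosyzygy_shortExact adj hR (cosyzygy M)
    have h0 : ∀ j, j < 2 → IsZero (L j (R 1 (cosyzygy M))) := fun j hj =>
      (H 2 le_rfl le_rfl M j hj).of_iso
        (hL.iso j (hR.nonempty_iso_cosyzygy 0 M).some).some
    obtain ⟨a, b, δ, -, -, e₃⟩ := hL.les_zero _ hq
    obtain ⟨e₄, -⟩ := exactPair_map_of_adjunction adj hq
    have := e₃.isIso e₄ (h0 1 (by omega)) ((h0 0 (by omega)).of_iso (hL.zero _).some.symm)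
    dsimp at this
    have := epi_counit_cosyzygy adj hI M
    have := isIso_map_imageCosyzygyι_comp_counit adj hI (cosyzygy M)
    have : IsIso (adj.counit.app (cosyzygy (cosyzygy M))) :=
      IsIso.of_isIso_comp_left (F.map (imageCosyzygyι G (cosyzygy M))) _
    set X := cosyzygy (cosyzygy M)
    have h := adj.counit.naturality (Injective.ι X)
    -- With both counits invertible, `F G X → F G I` is the mono `X → I`, so the connecting map out
    -- of `L 1` vanishes.
    have : Mono ((G ⋙ F).map (Injective.ι X) ≫ adj.counit.app (Injective.under X)) := by
      rw [h]
      exact mono_comp _ _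
    have : Mono (F.map (G.map (Injective.ι X))) :=
      mono_of_mono ((G ⋙ F).map (Injective.ι X)) (adj.counit.app (Injective.under X))
    obtain ⟨a, b, δ, -, e₂, e₃⟩ := hL.les_zero _ (imageCosyzygy_shortExact adj X)
    have hδ := e₃.eq_zero_of_mono
    have := e₂.epi_of_eq_zero hδ
    exact (hLI 0 _ inferInstance).of_epi b
  | succ m ih =>
    have h := ih (fun i h₁ h₂ => H i h₁ (by omega))
    set X := iteratedCosyzygy (m + 2) M
    change IsZero (L (m + 2) (imageCosyzygy G (cosyzygy X)))
    obtain ⟨q, w, hq⟩ := exists_imageCosyzygy_shortExact adj hR X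
    obtain ⟨-, -, -, a, b, -, -, -, e⟩ := hL.les_succ m _ hq
    have h₁ := e.isZero h ((H (m + 3) (by omega) (by omega) M (m + 1) (by omega)).of_iso
      (hL.iso _ (hR.nonempty_iso_iteratedCosyzygy (m + 2) 0 M).some).some)
    exact h₁.of_iso (hL.nonempty_iso m (imageCosyzygy_shortExact adj (cosyzygy X))
      (hLI _ _ inferInstance) (hLI _ _ inferInstance)).some

/-- A subobject `Y` of `R 1 X` is covered by a subobject `Z` of `G (cosyzygy X)`. -/
theorem exists_cover (adj : F ⊣ G) (hR : IsRightDerivedFamily G R) {X : B} {Y : A}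
    (f : Y ⟶ R 1 X) [Mono f] :
    ∃ (Z : A) (k : imageCosyzygy G X ⟶ Z) (q : Z ⟶ Y) (w : k ≫ q = 0)
      (ζ : Z ⟶ G.obj (cosyzygy X)), (ShortComplex.mk k q w).ShortExact ∧ Mono ζ ∧
        k ≫ ζ = imageCosyzygyι G X := by
  obtain ⟨δ, w, hδ⟩ := exists_imageCosyzygy_shortExact adj hR X
  have := hδ.epi_g
  have hm := hδ.mono_f
  dsimp at this hm
  let k : imageCosyzygy G X ⟶ Limits.pullback δ f :=
    Limits.pullback.lift (imageCosyzygyι G X) 0 (by rw [w, Limits.zero_comp])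
  have hk : k ≫ Limits.pullback.fst δ f = imageCosyzygyι G X := Limits.pullback.lift_fst _ _ _
  have hk' : k ≫ Limits.pullback.snd δ f = 0 := Limits.pullback.lift_snd _ _ _
  refine ⟨_, k, Limits.pullback.snd δ f, hk', Limits.pullback.fst δ f, ?_, inferInstance, hk⟩
  have : Mono k := by
    rw [← hk] at hm
    exact mono_of_mono k (Limits.pullback.fst δ f)
  refine ExactPair.shortExact ⟨hk', ?_⟩
  rw [ShortComplex.exact_iff_exact_up_to_refinements]
  intro W x hx
  dsimp at x hx
  obtain ⟨t, ht⟩ := (ExactPair.of_shortExact hδ).exists_lift (x ≫ Limits.pullback.fst δ f) (by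
    dsimp
    rw [Category.assoc, Limits.pullback.condition, reassoc_of% hx, Limits.zero_comp])
  refine ⟨W, 𝟙 _, inferInstance, t, ?_⟩
  dsimp at t ht ⊢
  rw [Category.id_comp, ← cancel_mono (Limits.pullback.fst δ f), Category.assoc, hk, ht]

/-- With `Z` the preimage of `Y` in `G (cosyzygy X)` and `C = G I / Z`, acyclicity of `G I`
identifies `L (m + 1) C` with `L m Z` for `m ≥ 1`, and with the kernel of `F Z → F G I` for `m = 0`
(up to an epi). It remains to see that this maps onto `L m Y`. -/
theorem exists_epi_of_mono (adj : F ⊣ G) (hL : IsLeftDerivedFamily F L)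
    (hR : IsRightDerivedFamily G R) (hI : ∀ I : B, Injective I → IsIso (adj.counit.app I))
    (hLI : ∀ (i : ℕ) (I : B), Injective I → IsZero (L (i + 1) (G.obj I))) (m : ℕ)
    (H : ∀ i, 2 ≤ i → i ≤ m → ∀ (M : B) j, j < i → IsZero (L j (R i M))) (M : B) {X : B}
    (hX : X = iteratedCosyzygy m M) {Y : A} (f : Y ⟶ R 1 X) [Mono f] :
    ∃ (C : A) (p : L (m + 1) C ⟶ L m Y), Epi p := by
  obtain ⟨Z, k, q, w, ζ, hS, hζ, hk⟩ := exists_cover adj hR f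
  have hι := (exactPair_map_of_adjunction' adj (cosyzygySequence_shortExact (cosyzygy X))).2
  dsimp at hι
  have hCS : (ShortComplex.mk (ζ ≫ G.map (Injective.ι (cosyzygy X)))
      (Limits.cokernel.π (ζ ≫ G.map (Injective.ι (cosyzygy X))))
      (Limits.cokernel.condition _)).ShortExact :=
    { exact := ShortComplex.exact_cokernel _
      mono_f := mono_comp _ _
      epi_g := by dsimp; infer_instance }
  refine ⟨Limits.cokernel (ζ ≫ G.map (Injective.ι (cosyzygy X))), ?_⟩
  cases m with
  | zero =>
    obtain ⟨a, b, δ, -, -, e⟩ := hL.les_zero _ hCS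
    have := hI (Injective.under (cosyzygy X)) inferInstance
    have := hI (Injective.under X) inferInstance
    set θ := F.map ζ ≫ adj.counit.app (cosyzygy X) with hθ
    have hθ' : F.map (ζ ≫ G.map (Injective.ι (cosyzygy X))) ≫ adj.counit.app _ =
        θ ≫ Injective.ι (cosyzygy X) := by
      have := adj.counit.naturality (Injective.ι (cosyzygy X))
      dsimp at this
      rw [F.map_comp, Category.assoc, this, hθ, Category.assoc]
    have hδ : ExactPair δ θ := by
      rw [← ExactPair.comp_mono_iff (Injective.ι (cosyzygy X)), ← hθ',
        ExactPair.comp_mono_iff]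
      exact e
    set β := F.map (Limits.cokernel.π (G.map (Injective.ι X)) ≫ k) with hβ
    have hβθ : β ≫ θ =
        adj.counit.app (Injective.under X) ≫ Limits.cokernel.π (Injective.ι X) := by
      rw [hβ, hθ, ← F.map_comp_assoc, Category.assoc, hk, π_imageCosyzygyι]
      exact adj.counit.naturality _
    have hepi : Epi (β ≫ θ) := by
      rw [hβθ]
      exact epi_comp _ _
    have : Epi θ := epi_of_epi β θ
    have := (exactPair_map_of_adjunction adj hS).2
    dsimp at this
    refine ⟨δ ≫ F.map q ≫ (hL.zero Y).some.inv, ?_⟩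
    suffices Epi (δ ≫ F.map q) by
      rw [← Category.assoc]
      exact epi_comp _ _
    -- `F Z` is generated by `ker θ` and the image of `β`, because `β ≫ θ` is epi; the image of `β`
    -- dies in `F Y`, so `ker θ` already covers `F Y`.
    refine Preadditive.epi_of_cancel_zero _ fun t ht => ?_
    obtain ⟨s, hs⟩ := hδ.exists_desc (F.map q ≫ t) (by simpa using ht)
    have hs0 : s = 0 := by
      rw [← cancel_epi (β ≫ θ), Category.assoc, hs, hβ, ← F.map_comp_assoc, Category.assoc, w]
      simp
    rw [← cancel_epi (F.map q), ← hs, hs0]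
    simp
  | succ m =>
    obtain ⟨iso⟩ := hL.nonempty_iso m hCS (hLI _ _ inferInstance) (hLI _ _ inferInstance)
    suffices ∃ p : L (m + 1) Z ⟶ L (m + 1) Y, Epi p by
      obtain ⟨p, hp⟩ := this
      exact ⟨iso.hom ≫ p, epi_comp _ _⟩
    match m with
    | 0 =>
      obtain rfl : X = cosyzygy M := hX
      obtain ⟨a, b, δ, -, e₂, e₃⟩ := hL.les_zero _ hS
      have := epi_counit_cosyzygy adj hI M
      have hiso := isIso_map_imageCosyzygyι_comp_counit adj hI (cosyzygy M)
      -- `F k` is the first factor of an isomorphism onto `cosyzygy X`, so the connecting map `L 1 Y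
      -- ⟶ F (imageCosyzygy G X)` is zero.
      have : Mono (F.map k) := by
        rw [← hk, F.map_comp, Category.assoc] at hiso
        exact mono_of_mono (F.map k) (F.map ζ ≫ adj.counit.app _)
      exact ⟨b, e₂.epi_of_eq_zero e₃.eq_zero_of_mono⟩
    | m + 1 =>
      subst hX
      obtain ⟨a, b, δ, a', b', -, e₂, -, -⟩ := hL.les_succ m _ hS
      exact ⟨b, e₂.epi (isZero_imageCosyzygy adj hL hR hI hLI m H M)⟩

end InjectiveSide

/-! ### The abstract equivalence. -/

section Main

variable {A B : Type*} [Category* A] [Abelian A] [Category* B] [Abelian B]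
  [EnoughProjectives A] [EnoughInjectives B]
  {F : A ⥤ B} {G : B ⥤ A} [F.Additive] [G.Additive] {L : ℕ → A → B} {R : ℕ → B → A}

/-- If all quotients of the `L i N` have `R`-cograde at least `i`, then all subobjects of the
`R i M` have `L`-cograde at least `i`. -/
theorem isZero_left_of_isZero_right (adj : F ⊣ G) (hL : IsLeftDerivedFamily F L)
    (hR : IsRightDerivedFamily G R) (hI : ∀ I : B, Injective I → IsIso (adj.counit.app I))
    (hLI : ∀ (i : ℕ) (I : B), Injective I → IsZero (L (i + 1) (G.obj I))) (n : ℕ)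
    (H : ∀ (N : A) (i : ℕ), 1 ≤ i → i ≤ n → ∀ (X : B) (p : L i N ⟶ X), Epi p →
      ∀ j, j < i → IsZero (R j X))
    (M : B) (i : ℕ) (hi : 1 ≤ i) (hin : i ≤ n) (Y : A) (f : Y ⟶ R i M) (hf : Mono f)
    (j : ℕ) (hj : j < i) : IsZero (L j Y) := by
  induction i using Nat.strong_induction_on generalizing M Y j with
  | _ i ih =>
    obtain ⟨m, rfl⟩ := Nat.exists_eq_add_of_le' hi
    -- For `m ≥ 1`, `R (m + 1) M ≅ R m (cosyzygy M)`, so `Y` is also a subobject in a lower degree.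
    have hlt : ∀ j, j < m → IsZero (L j Y) := fun j hj => by
      obtain ⟨m, rfl⟩ := Nat.exists_eq_add_of_le' (show 1 ≤ m by omega)
      exact ih (m + 1) (by omega) (cosyzygy M) (by omega) (by omega) Y
        (f ≫ (hR.nonempty_iso_cosyzygy m M).some.inv) (mono_comp _ _) j hj
    obtain h | rfl := Nat.lt_succ_iff_lt_or_eq.1 hj
    · exact hlt j h
    · have iso := (hR.nonempty_iso_iteratedCosyzygy j 0 M).some
      have : Mono (f ≫ iso.inv) := mono_comp _ _
      obtain ⟨C, p, hp⟩ := exists_epi_of_mono adj hL hR hI hLI j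
        (fun i h₁ h₂ M' j' hj' => ih i (by omega) M' (by omega) (by omega) _ (𝟙 _)
          inferInstance j' hj') M rfl (f ≫ iso.inv)
      exact isZero_of_isZero_right adj hL hR j hlt
        fun k hk => H C (j + 1) hi hin _ p hp k (by omega)

/-- Self-dual form of the equivalence, in abelian categories. -/
theorem cograde_symmetry (adj : F ⊣ G) (hL : IsLeftDerivedFamily F L)
    (hR : IsRightDerivedFamily G R) (hI : ∀ I : B, Injective I → IsIso (adj.counit.app I))
    (hLI : ∀ (i : ℕ) (I : B), Injective I → IsZero (L (i + 1) (G.obj I)))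
    (hP : ∀ P : A, Projective P → IsIso (adj.unit.app P))
    (hRP : ∀ (i : ℕ) (P : A), Projective P → IsZero (R (i + 1) (F.obj P))) (n : ℕ) :
    (∀ (N : A) (i : ℕ), 1 ≤ i → i ≤ n → ∀ (X : B) (p : L i N ⟶ X), Epi p →
      ∀ j, j < i → IsZero (R j X)) ↔
    (∀ (M : B) (i : ℕ), 1 ≤ i → i ≤ n → ∀ (Y : A) (f : Y ⟶ R i M), Mono f →
      ∀ j, j < i → IsZero (L j Y)) := by
  refine ⟨fun H => isZero_left_of_isZero_right adj hL hR hI hLI n H, fun H N i h₁ h₂ X p hp j hj =>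
    ?_⟩
  -- In the opposite categories `G.op ⊣ F.op`; projectives and injectives, unit and counit,
  -- quotients and subobjects are exchanged, so the converse is the same implication.
  refine IsZero.unop (isZero_left_of_isZero_right adj.op hR.op hL.op (fun I hI' => ?_)
    (fun i I hI' => (hRP i I.unop inferInstance).op) n
    (fun N i h₁ h₂ X p hp j hj => (H N.unop i h₁ h₂ X.unop p.unop inferInstance j hj).op)
    (Opposite.op N) i h₁ h₂ (Opposite.op X) p.op inferInstance j hj)
  have := hP I.unop inferInstance
  exact inferInstanceAs (IsIso (adj.unit.app I.unop).op)

end Main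

/-! ### Long exact sequences for left derived functors, by splicing and the snake lemma. -/

section Splice

/-- The augmentation of a projective resolution. -/
noncomputable def resolutionAugmentation {A : Type*} [Category* A] [Abelian A] {X : A}
    (Q : ProjectiveResolution X) : Q.complex.X 0 ⟶ X := Q.π.f 0

instance {A : Type*} [Category* A] [Abelian A] {X : A} (Q : ProjectiveResolution X) :
    Epi (resolutionAugmentation Q) := inferInstanceAs (Epi (Q.π.f 0))

theorem exactPair_resolutionAugmentation {A : Type*} [Category* A] [Abelian A] {X : A}
    (Q : ProjectiveResolution X) : ExactPair (Q.complex.d 1 0) (resolutionAugmentation Q) :=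
  ExactPair.of_exact Q.exact₀

variable {A : Type*} [Category* A] [Abelian A]

/-- The map `Q₀ ⟶ S.X₂` splicing a resolution of `S.X₁` to `S.X₂ ⟶ S.X₃`. -/
noncomputable def spliceMap {S : ShortComplex A} (Q : ProjectiveResolution S.X₁) : Q.complex.X 0 ⟶ S.X₂ :=
  resolutionAugmentation Q ≫ S.f

theorem d_spliceMap {S : ShortComplex A} (Q : ProjectiveResolution S.X₁) : Q.complex.d 1 0 ≫ spliceMap Q = 0 := by
  rw [spliceMap, ← Category.assoc, (exactPair_resolutionAugmentation Q).w, Limits.zero_comp]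

theorem exactPair_d_spliceMap {S : ShortComplex A} (hS : S.ShortExact)
    (Q : ProjectiveResolution S.X₁) : ExactPair (Q.complex.d 1 0) (spliceMap Q) := by
  have := hS.mono_f
  exact (ExactPair.comp_mono_iff S.f).2 (exactPair_resolutionAugmentation Q)

theorem exactPair_spliceMap {S : ShortComplex A} (hS : S.ShortExact)
    (Q : ProjectiveResolution S.X₁) : ExactPair (spliceMap Q) S.g :=
  (ExactPair.epi_comp_iff _).2 (ExactPair.of_shortExact hS)

/-- The complex `⋯ ⟶ Q₁ ⟶ Q₀ ⟶ S.X₂`. -/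
noncomputable def spliceComplex {S : ShortComplex A} (Q : ProjectiveResolution S.X₁) : ChainComplex A ℕ :=
  Q.complex.augment (spliceMap Q) (d_spliceMap Q)

theorem spliceComplex_exactAt_succ {S : ShortComplex A} (hS : S.ShortExact)
    (Q : ProjectiveResolution S.X₁) (n : ℕ) : (spliceComplex Q).ExactAt (n + 1) := by
  rw [HomologicalComplex.exactAt_iff' _ (n + 1 + 1) (n + 1) n (by simp) (by simp)]
  match n with
  | 0 => exact (exactPair_d_spliceMap hS Q).2
  | n + 1 => exact Q.exact_succ n

/-- A projective resolution of `S.X₃` obtained from one of `S.X₁` when `S.X₂` is projective. -/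
noncomputable def spliceResolution {S : ShortComplex A} (hS : S.ShortExact)
    (Q : ProjectiveResolution S.X₁) [Projective S.X₂] : ProjectiveResolution S.X₃ where
  complex := spliceComplex Q
  projective n := match n with
    | 0 => inferInstanceAs (Projective S.X₂)
    | n + 1 => Q.projective n
  π := (ChainComplex.toSingle₀Equiv _ _).symm ⟨S.g, (exactPair_spliceMap hS Q).w⟩
  quasiIso := ⟨fun n => by
    cases n
    · rw [ChainComplex.quasiIsoAt₀_iff, ShortComplex.quasiIso_iff_of_zeros']
      · have := hS.epi_g
        refine (ShortComplex.exact_and_epi_g_iff_of_iso ?_).2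
          ⟨(exactPair_spliceMap hS Q).2, this⟩
        exact ShortComplex.isoMk (Iso.refl _) (Iso.refl _) (Iso.refl _)
          ((Category.id_comp _).trans (Category.comp_id _).symm)
          ((Category.id_comp _).trans (Eq.trans (ChainComplex.toSingle₀Equiv_symm_apply_f_zero (C := spliceComplex Q) S.g
            (exactPair_spliceMap hS Q).w).symm (Category.comp_id _).symm))
      all_goals rfl
    · rw [quasiIsoAt_iff_exactAt']
      · exact spliceComplex_exactAt_succ hS Q _
      · apply ChainComplex.exactAt_succ_single_obj⟩

end Splice
-- `Z` is a model of the cokernel of `T.f`, and homology is the kernel of the map it induces.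
theorem exists_mono_of_homology {B : Type*} [Category* B] [Abelian B] (T : ShortComplex B) {Z : B}
    {p : T.X₂ ⟶ Z} {m : Z ⟶ T.X₃} (hepi : Epi p) (hp : ExactPair T.f p) (hm : p ≫ m = T.g) :
    ∃ k : T.homology ⟶ Z, Mono k ∧ ExactPair k m := by
  obtain ⟨s, hs⟩ := hp.exists_desc T.pOpcycles T.f_pOpcycles
  have hsm : s ≫ T.fromOpcycles = m := by
    rw [← cancel_epi p, reassoc_of% hs, hm, T.p_fromOpcycles]
  have : IsIso s := ⟨T.descOpcycles p hp.w, by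
    rw [← cancel_epi p, reassoc_of% hs, T.p_descOpcycles, Category.comp_id], by
    rw [← cancel_epi T.pOpcycles, T.p_descOpcycles_assoc, hs, Category.comp_id]⟩
  have h : ExactPair T.homologyι T.fromOpcycles :=
    ⟨T.homologyι_comp_fromOpcycles, ShortComplex.exact_of_f_is_kernel _ T.homologyIsKernel⟩
  refine ⟨T.homologyι ≫ inv s, mono_comp _ _, ?_⟩
  refine ⟨by rw [Category.assoc, ← hsm, IsIso.inv_hom_id_assoc, h.w], ?_⟩
  rw [ShortComplex.exact_iff_exact_up_to_refinements]
  intro W x hx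
  dsimp at x hx
  obtain ⟨t, ht⟩ := h.exists_lift (x ≫ s) (by rw [Category.assoc, hsm, hx])
  exact ⟨W, 𝟙 _, inferInstance, t, by
    dsimp
    rw [Category.id_comp, ← Category.assoc, ht, Category.assoc, IsIso.hom_inv_id,
      Category.comp_id]⟩

section LeftDerived

variable {A B : Type*} [Category* A] [Abelian A] [EnoughProjectives A] [Category* B] [Abelian B]
  (F : A ⥤ B) [F.Additive]

theorem nonempty_leftDerived_iso_homology {X : A} (P : ProjectiveResolution X) (i : ℕ) :
    Nonempty ((F.leftDerived (i + 1)).obj X ≅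
      (((F.mapHomologicalComplex _).obj P.complex).sc' (i + 2) (i + 1) i).homology) :=
  ⟨P.isoLeftDerivedObj F (i + 1) ≪≫ ShortComplex.homologyMapIso
    (((F.mapHomologicalComplex _).obj P.complex).isoSc' (i + 2) (i + 1) i (by simp) (by simp))⟩

/-- Splicing shifts `Q` by one, so both sides are the homology of the same three terms. -/
theorem nonempty_leftDerived_dimension_shift {S : ShortComplex A} (hS : S.ShortExact)
    [Projective S.X₂] (i : ℕ) :
    Nonempty ((F.leftDerived (i + 2)).obj S.X₃ ≅ (F.leftDerived (i + 1)).obj S.X₁) :=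
  let Q := projectiveResolution S.X₁
  ⟨(nonempty_leftDerived_iso_homology F (spliceResolution hS Q) (i + 1)).some ≪≫
    (nonempty_leftDerived_iso_homology F Q i).some.symm⟩

theorem exists_leftDerived_one_mono [Limits.PreservesFiniteColimits F] {S : ShortComplex A}
    (hS : S.ShortExact) [Projective S.X₂] :
    ∃ k : (F.leftDerived 1).obj S.X₃ ⟶ F.obj S.X₁, Mono k ∧ ExactPair k (F.map S.f) := by
  let Q := projectiveResolution S.X₁
  let e := (nonempty_leftDerived_iso_homology F (spliceResolution hS Q) 0).some
  have := NormalMonoCategory.preservesEpimorphisms_of_preservesCokernels F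
  have hQ : ExactPair (F.map (Q.complex.d 1 0)) (F.map (resolutionAugmentation Q)) :=
    ⟨_, (exactPair_resolutionAugmentation Q).2.map_of_epi_of_preservesCokernel F
      (inferInstanceAs (Epi (resolutionAugmentation Q))) inferInstance⟩
  obtain ⟨k, hk, hk'⟩ := exists_mono_of_homology
    (((F.mapHomologicalComplex _).obj (spliceResolution hS Q).complex).sc' 2 1 0)
    (p := F.map (resolutionAugmentation Q)) (m := F.map S.f)
    (F.map_epi (resolutionAugmentation Q)) hQ (F.map_comp _ _).symm
  exact ⟨e.hom ≫ k, mono_comp _ _, (ExactPair.epi_comp_iff _).2 hk'⟩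

end LeftDerived

section Snake

variable {C : Type*} [Category* C] [Abelian C]

theorem ExactPair.conj {X Y Z X' Y' Z' : C} {f : X ⟶ Y} {g : Y ⟶ Z} (h : ExactPair f g)
    (a : X' ≅ X) (b : Y' ≅ Y) (c : Z' ≅ Z) :
    ExactPair (a.hom ≫ f ≫ b.inv) (b.hom ≫ g ≫ c.inv) := by
  rw [ExactPair.epi_comp_iff, ← Category.assoc, ExactPair.comp_mono_iff]
  have w : (f ≫ b.inv) ≫ b.hom ≫ g = 0 := by simpa using h.w
  exact ⟨w, ShortComplex.exact_of_iso (S₁ := ShortComplex.mk f g h.1)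
    (S₂ := ShortComplex.mk (f ≫ b.inv) (b.hom ≫ g) w)
    (ShortComplex.isoMk (Iso.refl _) b.symm (Iso.refl _) (by simp) (by simp)) h.2⟩

theorem ExactPair.of_epi {X Y Z : C} (f : X ⟶ Y) [Epi f] (hZ : IsZero Z) (g : Y ⟶ Z) :
    ExactPair f g := by
  obtain rfl : g = 0 := hZ.eq_of_tgt _ _
  exact ⟨Limits.comp_zero, (ShortComplex.exact_iff_epi _ rfl).2 ‹_›⟩

/-- The input of the snake lemma, with columns checked componentwise. -/
noncomputable def snakeInputOfColumns {L₀ L₁ L₂ L₃ : ShortComplex C} (v₀₁ : L₀ ⟶ L₁)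
    (v₁₂ : L₁ ⟶ L₂) (v₂₃ : L₂ ⟶ L₃) (k₁ : Mono v₀₁.τ₁) (k₂ : Mono v₀₁.τ₂) (k₃ : Mono v₀₁.τ₃)
    (e₁ : ExactPair v₀₁.τ₁ v₁₂.τ₁) (e₂ : ExactPair v₀₁.τ₂ v₁₂.τ₂) (e₃ : ExactPair v₀₁.τ₃ v₁₂.τ₃)
    (c₁ : Epi v₂₃.τ₁) (c₂ : Epi v₂₃.τ₂) (c₃ : Epi v₂₃.τ₃)
    (f₁ : ExactPair v₁₂.τ₁ v₂₃.τ₁) (f₂ : ExactPair v₁₂.τ₂ v₂₃.τ₂) (f₃ : ExactPair v₁₂.τ₃ v₂₃.τ₃)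
    (h₁ : L₁.Exact) (h₁' : Epi L₁.g) (h₂ : L₂.Exact) (h₂' : Mono L₂.f) :
    ShortComplex.SnakeInput C where
  L₀ := L₀
  L₁ := L₁
  L₂ := L₂
  L₃ := L₃
  v₀₁ := v₀₁
  v₁₂ := v₁₂
  v₂₃ := v₂₃
  w₀₂ := ShortComplex.hom_ext _ _ e₁.w e₂.w e₃.w
  w₁₃ := ShortComplex.hom_ext _ _ f₁.w f₂.w f₃.w
  h₀ := ShortComplex.isLimitOfIsLimitπ _
    ((Limits.KernelFork.isLimitMapConeEquiv _ _).symm (@ShortComplex.Exact.fIsKernel _ _ _ _ _ e₁.2 k₁))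
    ((Limits.KernelFork.isLimitMapConeEquiv _ _).symm (@ShortComplex.Exact.fIsKernel _ _ _ _ _ e₂.2 k₂))
    ((Limits.KernelFork.isLimitMapConeEquiv _ _).symm (@ShortComplex.Exact.fIsKernel _ _ _ _ _ e₃.2 k₃))
  h₃ := ShortComplex.isColimitOfIsColimitπ _
    ((Limits.CokernelCofork.isColimitMapCoconeEquiv _ _).symm
      (@ShortComplex.Exact.gIsCokernel _ _ _ _ _ f₁.2 c₁))
    ((Limits.CokernelCofork.isColimitMapCoconeEquiv _ _).symm
      (@ShortComplex.Exact.gIsCokernel _ _ _ _ _ f₂.2 c₂))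
    ((Limits.CokernelCofork.isColimitMapCoconeEquiv _ _).symm
      (@ShortComplex.Exact.gIsCokernel _ _ _ _ _ f₃.2 c₃))
  L₁_exact := h₁
  epi_L₁_g := h₁'
  L₂_exact := h₂
  mono_L₂_f := h₂'

end Snake

section Presentation

open ZeroObject

variable {A : Type*} [Category* A] [Abelian A]

/-- The horizontal rows and the vertical columns of a commutative `3 × 3` diagram expressing a
short exact sequence of projective presentations. -/
structure IsPresentation {K P S : ShortComplex A} (i : K ⟶ P) (p : P ⟶ S) : Prop where
  shortExact : K.ShortExact
  splitting : Nonempty P.Splitting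
  w₁ : i.τ₁ ≫ p.τ₁ = 0
  w₂ : i.τ₂ ≫ p.τ₂ = 0
  w₃ : i.τ₃ ≫ p.τ₃ = 0
  column₁ : (ShortComplex.mk i.τ₁ p.τ₁ w₁).ShortExact
  column₂ : (ShortComplex.mk i.τ₂ p.τ₂ w₂).ShortExact
  column₃ : (ShortComplex.mk i.τ₃ p.τ₃ w₃).ShortExact
  projective₁ : Projective P.X₁
  projective₂ : Projective P.X₂
  projective₃ : Projective P.X₃

/-- The horseshoe lemma. The row of kernels is short exact by the snake lemma applied with a zero
row of cokernels. -/
theorem exists_isPresentation [EnoughProjectives A] {S : ShortComplex A} (hS : S.ShortExact) :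
    ∃ (K P : ShortComplex A) (i : K ⟶ P) (p : P ⟶ S), IsPresentation i p := by
  have := hS.epi_g
  have := hS.mono_f
  let P : ShortComplex A := ShortComplex.mk
    (Limits.biprod.inl : Projective.over S.X₁ ⟶ Projective.over S.X₁ ⊞ Projective.over S.X₃)
    Limits.biprod.snd (by simp)
  let sP : P.Splitting := ShortComplex.Splitting.ofHasBinaryBiproduct _ _
  let p : P ⟶ S :=
    { τ₁ := Projective.π _
      τ₂ := Limits.biprod.desc (Projective.π _ ≫ S.f)
        (Projective.factorThru (Projective.π S.X₃) S.g)
      τ₃ := Projective.π _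
      comm₁₂ := by simp [P]
      comm₂₃ := by
        apply Limits.biprod.hom_ext' <;> simp [P] }
  have e₁ : Epi p.τ₁ := inferInstanceAs (Epi (Projective.π _))
  have e₃ : Epi p.τ₃ := inferInstanceAs (Epi (Projective.π _))
  have e₂ : Epi p.τ₂ := ShortComplex.epi_of_epi_of_epi_of_epi p hS.exact sP.shortExact.epi_g e₁ e₃
  let Z : ShortComplex A := ShortComplex.mk (0 : (0 : A) ⟶ 0) (0 : (0 : A) ⟶ 0) (by simp)
  have hZ : IsZero (0 : A) := Limits.isZero_zero A
  let K : ShortComplex A := ShortComplex.mk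
    (Limits.kernel.map p.τ₁ p.τ₂ P.f S.f p.comm₁₂)
    (Limits.kernel.map p.τ₂ p.τ₃ P.g S.g p.comm₂₃)
    (by rw [← cancel_mono (Limits.kernel.ι p.τ₃)]; simp)
  let i : K ⟶ P :=
    { τ₁ := Limits.kernel.ι _, τ₂ := Limits.kernel.ι _, τ₃ := Limits.kernel.ι _
      comm₁₂ := by simp [K]
      comm₂₃ := by simp [K] }
  have k₁ : (ShortComplex.mk i.τ₁ p.τ₁ (Limits.kernel.condition _)).ShortExact :=
    { exact := ShortComplex.exact_kernel _
      mono_f := inferInstanceAs (Mono (Limits.kernel.ι _)), epi_g := e₁ }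
  have k₂ : (ShortComplex.mk i.τ₂ p.τ₂ (Limits.kernel.condition _)).ShortExact :=
    { exact := ShortComplex.exact_kernel _
      mono_f := inferInstanceAs (Mono (Limits.kernel.ι _)), epi_g := e₂ }
  have k₃ : (ShortComplex.mk i.τ₃ p.τ₃ (Limits.kernel.condition _)).ShortExact :=
    { exact := ShortComplex.exact_kernel _
      mono_f := inferInstanceAs (Mono (Limits.kernel.ι _)), epi_g := e₃ }
  have hz : ∀ {X : A} (f : X ⟶ 0), Epi f := fun f => hZ.epi f
  let q : S ⟶ Z := { τ₁ := 0, τ₂ := 0, τ₃ := 0 }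
  let T := snakeInputOfColumns i p q k₁.mono_f k₂.mono_f k₃.mono_f
    (.of_shortExact k₁) (.of_shortExact k₂) (.of_shortExact k₃) (hz _) (hz _) (hz _)
    (.of_epi _ hZ _) (.of_epi _ hZ _) (.of_epi _ hZ _) sP.shortExact.exact sP.shortExact.epi_g
    hS.exact hS.mono_f
  have hT : Mono T.L₁.f := sP.shortExact.mono_f
  have hK : Mono K.f := inferInstanceAs (Mono T.L₀.f)
  have hK' : Epi K.g := T.L₁'_exact.epi_f (hZ.eq_of_tgt _ _)
  exact ⟨K, P, i, p, ShortComplex.ShortExact.mk' T.L₀_exact hK hK', ⟨sP⟩, _, _, _, k₁, k₂, k₃,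
    Projective.projective_over _, inferInstanceAs (Projective (_ ⊞ _)),
    Projective.projective_over _⟩

end Presentation

section LeftDerivedFamily

theorem exactPair_map_of_preservesFiniteColimits {A B : Type*} [Category* A] [Abelian A]
    [Category* B] [Abelian B] (F : A ⥤ B) [F.Additive] [Limits.PreservesFiniteColimits F]
    {S : ShortComplex A} (hS : S.ShortExact) :
    ExactPair (F.map S.f) (F.map S.g) ∧ Epi (F.map S.g) := by
  have := NormalMonoCategory.preservesEpimorphisms_of_preservesCokernels F
  have := hS.epi_g
  exact ⟨⟨_, hS.exact.map_of_epi_of_preservesCokernel F inferInstance inferInstance⟩,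
    F.map_epi _⟩

variable {A B : Type*} [Category* A] [Abelian A] [EnoughProjectives A] [Category* B] [Abelian B]
  (F : A ⥤ B) [F.Additive] [Limits.PreservesFiniteColimits F]

/-- `L 1` of each term of `S` is the kernel in a column of `F K → F P → F S`, so the snake lemma
gives the sequence. The embeddings `k₁`, `k₂` are kept in order to glue on degree two. -/
theorem exists_leftDerived_snake {K P S : ShortComplex A} {i : K ⟶ P} {p : P ⟶ S}
    (h : IsPresentation i p) :
    ∃ (k₁ : (F.leftDerived 1).obj S.X₁ ⟶ F.obj K.X₁)
      (a : (F.leftDerived 1).obj S.X₁ ⟶ (F.leftDerived 1).obj S.X₂)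
      (k₂ : (F.leftDerived 1).obj S.X₂ ⟶ F.obj K.X₂)
      (b : (F.leftDerived 1).obj S.X₂ ⟶ (F.leftDerived 1).obj S.X₃)
      (δ : (F.leftDerived 1).obj S.X₃ ⟶ F.obj S.X₁),
      Mono k₁ ∧ Mono k₂ ∧ ExactPair k₁ (F.map i.τ₁) ∧ a ≫ k₂ = k₁ ≫ F.map K.f ∧
      ExactPair a b ∧ ExactPair b δ ∧ ExactPair δ (F.map S.f) := by
  have := h.projective₁
  have := h.projective₂
  have := h.projective₃
  obtain ⟨k₁, m₁, e₁⟩ := exists_leftDerived_one_mono F h.column₁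
  obtain ⟨k₂, m₂, e₂⟩ := exists_leftDerived_one_mono F h.column₂
  obtain ⟨k₃, m₃, e₃⟩ := exists_leftDerived_one_mono F h.column₃
  have hK := exactPair_map_of_preservesFiniteColimits F h.shortExact
  have c₁ := exactPair_map_of_preservesFiniteColimits F h.column₁
  have c₂ := exactPair_map_of_preservesFiniteColimits F h.column₂
  have c₃ := exactPair_map_of_preservesFiniteColimits F h.column₃
  dsimp at e₁ e₂ e₃ c₁ c₂ c₃
  have sP := (h.splitting.some.map F).shortExact
  obtain ⟨a, ha⟩ := e₂.exists_lift (k₁ ≫ F.map K.f) (by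
    rw [Category.assoc, ← F.map_comp, ← i.comm₁₂, F.map_comp, ← Category.assoc, e₁.w,
      Limits.zero_comp])
  obtain ⟨b, hb⟩ := e₃.exists_lift (k₂ ≫ F.map K.g) (by
    rw [Category.assoc, ← F.map_comp, ← i.comm₂₃, F.map_comp, ← Category.assoc, e₂.w,
      Limits.zero_comp])
  let L₀ : ShortComplex B := ShortComplex.mk a b (by
    rw [← cancel_mono k₃, Category.assoc, hb, reassoc_of% ha, hK.1.w]; simp)
  let v₀₁ : L₀ ⟶ K.map F := { τ₁ := k₁, τ₂ := k₂, τ₃ := k₃, comm₁₂ := ha.symm, comm₂₃ := hb.symm }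
  let T := snakeInputOfColumns v₀₁ (F.mapShortComplex.map i) (F.mapShortComplex.map p) m₁ m₂ m₃
    e₁ e₂ e₃ c₁.2 c₂.2 c₃.2 c₁.1 c₂.1 c₃.1 hK.1.2 hK.2 sP.exact sP.mono_f
  exact ⟨k₁, a, k₂, b, T.δ, m₁, m₂, e₁, ha, ⟨_, T.L₀_exact⟩, ⟨_, T.L₁'_exact⟩,
    ⟨_, T.L₂'_exact⟩⟩

theorem leftDerived_les_zero {S : ShortComplex A} (hS : S.ShortExact) :
    ∃ (a : (F.leftDerived 1).obj S.X₁ ⟶ (F.leftDerived 1).obj S.X₂)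
      (b : (F.leftDerived 1).obj S.X₂ ⟶ (F.leftDerived 1).obj S.X₃)
      (δ : (F.leftDerived 1).obj S.X₃ ⟶ F.obj S.X₁),
      ExactPair a b ∧ ExactPair b δ ∧ ExactPair δ (F.map S.f) := by
  obtain ⟨K, P, i, p, h⟩ := exists_isPresentation hS
  obtain ⟨k₁, a, k₂, b, δ, -, -, -, -, h₁, h₂, h₃⟩ := exists_leftDerived_snake F h
  exact ⟨a, b, δ, h₁, h₂, h₃⟩

theorem leftDerived_les_succ (n : ℕ) {S : ShortComplex A} (hS : S.ShortExact) :
    ∃ (a : (F.leftDerived (n + 2)).obj S.X₁ ⟶ (F.leftDerived (n + 2)).obj S.X₂)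
      (b : (F.leftDerived (n + 2)).obj S.X₂ ⟶ (F.leftDerived (n + 2)).obj S.X₃)
      (δ : (F.leftDerived (n + 2)).obj S.X₃ ⟶ (F.leftDerived (n + 1)).obj S.X₁)
      (a' : (F.leftDerived (n + 1)).obj S.X₁ ⟶ (F.leftDerived (n + 1)).obj S.X₂)
      (b' : (F.leftDerived (n + 1)).obj S.X₂ ⟶ (F.leftDerived (n + 1)).obj S.X₃),
      ExactPair a b ∧ ExactPair b δ ∧ ExactPair δ a' ∧ ExactPair a' b' := by
  induction n generalizing S with
  | zero =>
    obtain ⟨K, P, i, p, h⟩ := exists_isPresentation hS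
    have := h.projective₁
    have := h.projective₂
    have := h.projective₃
    obtain ⟨k₁, a', k₂, b', δ, m₁, m₂, e₁, ha', h₁, h₂, h₃⟩ := exists_leftDerived_snake F h
    obtain ⟨a, b, ε, h₄, h₅, h₆⟩ := leftDerived_les_zero F h.shortExact
    have sP := (h.splitting.some.map F).shortExact.mono_f
    -- The connecting map of the syzygy row ends in `F K.X₁`. It lands in the kernel `L 1 S.X₁` of
    -- `F K.X₁ → F P.X₁`, because `F P.X₁ → F P.X₂` is mono, the projective row being split.
    obtain ⟨d, hd⟩ := e₁.exists_lift ε (by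
      have : Mono (F.map P.f) := sP
      rw [← cancel_mono (F.map P.f), Category.assoc, ← F.map_comp, i.comm₁₂, F.map_comp,
        reassoc_of% h₆.w, Limits.zero_comp, Limits.zero_comp])
    have hbd : ExactPair b d := by rwa [← ExactPair.comp_mono_iff k₁, hd]
    have hda : ExactPair d a' := by
      refine ⟨by rw [← cancel_mono k₂, Category.assoc, ha', reassoc_of% hd, h₆.w]; simp, ?_⟩
      rw [ShortComplex.exact_iff_exact_up_to_refinements]
      intro W x hx
      dsimp at x hx
      obtain ⟨W', π, hπ, y, hy⟩ := h₆.2.exact_up_to_refinements (x ≫ k₁) (by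
        dsimp
        rw [Category.assoc, ← ha', reassoc_of% hx, Limits.zero_comp])
      refine ⟨W', π, hπ, y, ?_⟩
      dsimp at hy ⊢
      rw [← cancel_mono k₁, Category.assoc, Category.assoc, hd, hy]
    let s₁ := (nonempty_leftDerived_dimension_shift F h.column₁ 0).some
    let s₂ := (nonempty_leftDerived_dimension_shift F h.column₂ 0).some
    let s₃ := (nonempty_leftDerived_dimension_shift F h.column₃ 0).some
    have hδ := hbd.conj s₂ s₃ (Iso.refl _)
    exact ⟨_, _, _, a', b', h₄.conj s₁ s₂ s₃, hδ,
      (ExactPair.epi_comp_iff _).2 (by simpa using hda), h₁⟩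
  | succ n ih =>
    obtain ⟨K, P, i, p, h⟩ := exists_isPresentation hS
    have := h.projective₁
    have := h.projective₂
    have := h.projective₃
    obtain ⟨a, b, δ, a', b', h₁, h₂, h₃, h₄⟩ := ih h.shortExact
    let s₁ := fun n => (nonempty_leftDerived_dimension_shift F h.column₁ n).some
    let s₂ := fun n => (nonempty_leftDerived_dimension_shift F h.column₂ n).some
    let s₃ := fun n => (nonempty_leftDerived_dimension_shift F h.column₃ n).some
    exact ⟨_, _, _, _, _, h₁.conj (s₁ _) (s₂ _) (s₃ _), h₂.conj (s₂ _) (s₃ _) (s₁ _),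
      h₃.conj (s₃ _) (s₁ _) (s₂ _), h₄.conj (s₁ _) (s₂ _) (s₃ _)⟩

theorem isLeftDerivedFamily_leftDerived :
    IsLeftDerivedFamily F (fun n N => (F.leftDerived n).obj N) where
  zero N := ⟨F.leftDerivedZeroIsoSelf.app N⟩
  iso i _ _ e := ⟨(F.leftDerived i).mapIso e⟩
  projective i P _ := F.isZero_leftDerived_obj_projective_succ i P
  les_zero _ hS := leftDerived_les_zero F hS
  les_succ n _ hS := leftDerived_les_succ F n hS

end LeftDerivedFamily

/-! ### The functor `Hom_R(ω, -)` and `S`-linear long exact Ext sequences. -/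

section HomModule

variable (R S ω : Type u) [Ring R] [Ring S] [AddCommGroup ω] [Module R ω] [Module Sᵐᵒᵖ ω]
  [SMulCommClass R Sᵐᵒᵖ ω]

/-- `Hom_R(ω, M)`, a left `S`-module through `(s f)(x) = f (x s)`. -/
def HomModule (_S : Type u) (M : Type u) [AddCommGroup M] [Module R M] : Type u := ω →ₗ[R] M

variable (M : Type u) [AddCommGroup M] [Module R M]

instance : AddCommGroup (HomModule R ω S M) := inferInstanceAs (AddCommGroup (ω →ₗ[R] M))

instance : Module S (HomModule R ω S M) where
  smul s f := (show ω →ₗ[R] M from f) ∘ₗ (rightMul R S ω s).hom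
  one_smul f := LinearMap.ext fun x => congrArg (show ω →ₗ[R] M from f) (one_smul Sᵐᵒᵖ x)
  mul_smul s t f := LinearMap.ext fun x => congrArg (show ω →ₗ[R] M from f)
    (mul_smul (MulOpposite.op t) (MulOpposite.op s) x)
  smul_zero _ := rfl
  smul_add _ _ _ := rfl
  add_smul s t f := LinearMap.ext fun x =>
    (congrArg (show ω →ₗ[R] M from f) (add_smul (MulOpposite.op s) (MulOpposite.op t) x)).trans
      (map_add _ _ _)
  zero_smul f := LinearMap.ext fun x =>
    (congrArg (show ω →ₗ[R] M from f) (zero_smul Sᵐᵒᵖ x)).trans (map_zero _)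

variable {R S ω M}

instance : FunLike (HomModule R ω S M) ω M := inferInstanceAs (FunLike (ω →ₗ[R] M) ω M)

instance : LinearMapClass (HomModule R ω S M) R ω M :=
  inferInstanceAs (LinearMapClass (ω →ₗ[R] M) R ω M)

namespace HomModule

/-- The underlying linear map. -/
def toLinearMap (f : HomModule R ω S M) : ω →ₗ[R] M := f

/-- Postcomposition with `g`, as an `S`-linear map. -/
def postcomp {M' : Type u} [AddCommGroup M'] [Module R M'] (g : M →ₗ[R] M') :
    HomModule R ω S M →ₗ[S] HomModule R ω S M' where
  toFun f := (g ∘ₗ f.toLinearMap : ω →ₗ[R] M')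
  map_add' _ _ := LinearMap.ext fun _ => map_add g _ _
  map_smul' _ _ := rfl

end HomModule

variable (R S ω)

/-- The functor `Hom_R(ω, -)` from left `R`-modules to left `S`-modules. -/
def homFunctor : ModuleCat.{u} R ⥤ ModuleCat.{u} S where
  obj M := ModuleCat.of S (HomModule R ω S M)
  map g := ModuleCat.ofHom (HomModule.postcomp g.hom)
  map_id _ := rfl
  map_comp _ _ := rfl

instance : (homFunctor R S ω).Additive where
  map_add := rfl

end HomModule

section Ext

variable (R S ω : Type u) [Ring R] [Ring S] [AddCommGroup ω] [Module R ω] [Module Sᵐᵒᵖ ω]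
  [SMulCommClass R Sᵐᵒᵖ ω]

/-- Postcomposition with a class in `Ext^a(M, M')`, as an `S`-linear map. -/
noncomputable def extPostcomp {M M' : ModuleCat.{u} R} {a : ℕ} (c : Ext.{u} M M' a) {i j : ℕ}
    (h : i + a = j) : extObj R S ω i M ⟶ extObj R S ω j M' :=
  letI := extModule R S ω i M
  letI := extModule R S ω j M'
  ModuleCat.ofHom
    { toFun := fun e : Ext.{u} (ModuleCat.of R ω) M i => e.comp c h
      map_add' := fun e e' => Ext.add_comp _ _ _ _
      map_smul' := fun s e => Ext.comp_assoc _ _ _ _ _ (by omega) }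

/-- Sending a homomorphism `f` to the composite of its class in `Ext^0` with a class in
`Ext^a(M, M')`, as an `S`-linear map. -/
noncomputable def homPostcomp {M M' : ModuleCat.{u} R} {a : ℕ} (c : Ext.{u} M M' a) :
    (homFunctor R S ω).obj M ⟶ extObj R S ω a M' :=
  letI := extModule R S ω a M'
  ModuleCat.ofHom
    { toFun := fun f : HomModule R ω S M =>
        (Ext.mk₀ (ModuleCat.ofHom f.toLinearMap)).comp c (zero_add a)
      map_add' := fun f f' => by
        rw [← Ext.add_comp, ← Ext.mk₀_add]
        rfl
      map_smul' := fun s f => by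
        refine Eq.trans ?_ (Ext.mk₀_comp_mk₀_assoc (rightMul R S ω s)
          (ModuleCat.ofHom f.toLinearMap) c).symm
        rfl }

variable {R S ω}

theorem exactPair_of_apply {X Y Z : ModuleCat.{u} S} (f : X ⟶ Y) (g : Y ⟶ Z)
    (h₁ : ∀ x, g (f x) = 0) (h₂ : ∀ y, g y = 0 → ∃ x, f x = y) : ExactPair f g :=
  have w : f ≫ g = 0 := by ext x; exact h₁ x
  ⟨w, (ShortComplex.moduleCat_exact_iff _).2 h₂⟩

variable {T : ShortComplex (ModuleCat.{u} R)}

theorem extPostcomp_exact₂ (hT : T.ShortExact) (i : ℕ) :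
    ExactPair (extPostcomp R S ω (Ext.mk₀ T.f) (add_zero i))
      (extPostcomp R S ω (Ext.mk₀ T.g) (add_zero i)) :=
  exactPair_of_apply _ _ (fun (x : Ext.{u} (ModuleCat.of R ω) T.X₁ i) => by
      refine (Ext.comp_assoc_of_third_deg_zero x (Ext.mk₀ T.f) (Ext.mk₀ T.g) (by omega)).trans ?_
      rw [Ext.mk₀_comp_mk₀, T.zero, Ext.mk₀_zero, Ext.comp_zero]
      rfl)
    (fun y hy => Ext.covariant_sequence_exact₂ _ hT y hy)

theorem extPostcomp_exact₃ (hT : T.ShortExact) (i : ℕ) :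
    ExactPair (extPostcomp R S ω (Ext.mk₀ T.g) (add_zero i))
      (extPostcomp R S ω hT.extClass (rfl : i + 1 = i + 1)) :=
  exactPair_of_apply _ _ (fun (x : Ext.{u} (ModuleCat.of R ω) T.X₂ i) => by
      refine (Ext.comp_assoc_of_second_deg_zero x (Ext.mk₀ T.g) hT.extClass (by omega)).trans ?_
      rw [hT.comp_extClass, Ext.comp_zero]
      rfl)
    (fun y hy => Ext.covariant_sequence_exact₃ _ hT y rfl hy)

theorem extPostcomp_exact₁ (hT : T.ShortExact) (i : ℕ) :
    ExactPair (extPostcomp R S ω hT.extClass (rfl : i + 1 = i + 1))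
      (extPostcomp R S ω (Ext.mk₀ T.f) (add_zero (i + 1))) :=
  exactPair_of_apply _ _ (fun (x : Ext.{u} (ModuleCat.of R ω) T.X₃ i) => by
      refine (Ext.comp_assoc_of_third_deg_zero x hT.extClass (Ext.mk₀ T.f) (by omega)).trans ?_
      rw [hT.extClass_comp, Ext.comp_zero]
      rfl)
    (fun y hy => Ext.covariant_sequence_exact₁ _ hT y hy rfl)

theorem extPostcomp_comp_of_eq_id {i : ℕ} {M M' : ModuleCat.{u} R} (f : M ⟶ M') (g : M' ⟶ M)
    (h : f ≫ g = 𝟙 M) : extPostcomp R S ω (Ext.mk₀ f) (add_zero i) ≫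
      extPostcomp R S ω (Ext.mk₀ g) (add_zero i) = 𝟙 _ := by
  ext (x : Ext.{u} (ModuleCat.of R ω) M i)
  refine (Ext.comp_assoc_of_third_deg_zero x (Ext.mk₀ f) (Ext.mk₀ g) (by omega)).trans ?_
  rw [Ext.mk₀_comp_mk₀, h]
  exact Ext.comp_mk₀_id x

/-- `Hom_R(ω, M) ≅ Ext^0_R(ω, M)`. -/
theorem isIso_homPostcomp_id (M : ModuleCat.{u} R) :
    IsIso (homPostcomp R S ω (Ext.mk₀ (𝟙 M))) := by
  rw [ConcreteCategory.isIso_iff_bijective]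
  have h : ∀ f : HomModule R ω S M, homPostcomp R S ω (Ext.mk₀ (𝟙 M)) f =
      Ext.mk₀ (ModuleCat.ofHom f.toLinearMap) := fun f => Ext.comp_mk₀_id _
  constructor
  · intro (f : HomModule R ω S M) (g : HomModule R ω S M) hfg
    have h' := (h f).symm.trans (hfg.trans (h g))
    exact congrArg ModuleCat.Hom.hom (Ext.addEquiv₀.symm.injective h')
  · intro (e : Ext.{u} (ModuleCat.of R ω) M 0)
    obtain ⟨f, rfl⟩ := Ext.addEquiv₀.symm.surjective e
    exact ⟨f.hom, h _⟩

variable (R S ω) in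
theorem isRightDerivedFamily_ext :
    IsRightDerivedFamily (homFunctor R S ω) (fun i M => extObj R S ω i M) where
  zero M := by
    have := isIso_homPostcomp_id (S := S) (ω := ω) M
    exact ⟨(asIso (homPostcomp R S ω (Ext.mk₀ (𝟙 M)))).symm⟩
  iso i M M' e := ⟨{
    hom := extPostcomp R S ω (Ext.mk₀ e.hom) (add_zero i)
    inv := extPostcomp R S ω (Ext.mk₀ e.inv) (add_zero i)
    hom_inv_id := extPostcomp_comp_of_eq_id _ _ e.hom_inv_id
    inv_hom_id := extPostcomp_comp_of_eq_id _ _ e.inv_hom_id }⟩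
  injective i I _ := by
    have : Subsingleton (extObj R S ω (i + 1) I) :=
      subsingleton_of_forall_eq 0
        (Ext.eq_zero_of_injective (X := ModuleCat.of R ω) (I := I) (n := i))
    exact ModuleCat.isZero_of_subsingleton _
  les_zero T hT := by
    refine ⟨homPostcomp R S ω hT.extClass, extPostcomp R S ω (Ext.mk₀ T.f) (add_zero _),
      extPostcomp R S ω (Ext.mk₀ T.g) (add_zero _),
      exactPair_of_apply _ _ (fun (f : HomModule R ω S T.X₂) => ?_)
        (fun (f : HomModule R ω S T.X₃) hf => ?_),
      exactPair_of_apply _ _ (fun (f : HomModule R ω S T.X₃) => ?_)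
        (fun (e : Ext.{u} (ModuleCat.of R ω) T.X₁ 1) he => ?_), extPostcomp_exact₂ hT 1⟩
    · refine (Ext.mk₀_comp_mk₀_assoc (ModuleCat.ofHom f.toLinearMap) T.g hT.extClass).symm.trans ?_
      rw [hT.comp_extClass, Ext.comp_zero]
      rfl
    -- Exactness is known for `Ext^0`; its classes are turned back into actual homomorphisms through
    -- `Ext.addEquiv₀`.
    · obtain ⟨e, he⟩ := Ext.covariant_sequence_exact₃ _ hT _ (zero_add 1) hf
      obtain ⟨g, rfl⟩ := Ext.addEquiv₀.symm.surjective e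
      refine ⟨g.hom, ?_⟩
      have he' := (Ext.mk₀_comp_mk₀ g T.g).symm.trans he
      exact congrArg ModuleCat.Hom.hom (Ext.addEquiv₀.symm.injective he')
    · refine (Ext.comp_assoc_of_third_deg_zero (Ext.mk₀ (ModuleCat.ofHom f.toLinearMap))
        hT.extClass (Ext.mk₀ T.f) (by omega)).trans ?_
      rw [hT.extClass_comp, Ext.comp_zero]
      rfl
    · obtain ⟨y, hy⟩ := Ext.covariant_sequence_exact₁ _ hT e he (zero_add 1)
      obtain ⟨g, rfl⟩ := Ext.addEquiv₀.symm.surjective y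
      exact ⟨g.hom, hy⟩
  les_succ i T hT := ⟨_, _, _, _, _, extPostcomp_exact₂ hT _, extPostcomp_exact₃ hT _,
    extPostcomp_exact₁ hT _, extPostcomp_exact₂ hT _⟩

end Ext

/-! ### Balanced tensor products and the tensor-hom adjunction. -/

section BalancedLift

variable {R S ω : Type u} [Ring R] [Ring S] [AddCommGroup ω] [Module R ω] [Module Sᵐᵒᵖ ω]
  {N : Type u} [AddCommGroup N] [Module S N] {P : Type u} [AddCommGroup P] [Module R P]

variable (R S) in
/-- The class of `x ⊗ y` in `ω ⊗_S N`. -/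
def balancedTmul (x : ω) (y : N) : BalancedTensor R S ω N :=
  (balancedRel R S ω N).mkQ (x ⊗ₜ[ℤ] y)

theorem balancedTmul_add (x : ω) (y y' : N) :
    balancedTmul R S x (y + y') = balancedTmul R S x y + balancedTmul R S x y' := by
  simp only [balancedTmul, TensorProduct.tmul_add, map_add]

theorem add_balancedTmul (x x' : ω) (y : N) :
    balancedTmul R S (x + x') y = balancedTmul R S x y + balancedTmul R S x' y := by
  simp only [balancedTmul, TensorProduct.add_tmul, map_add]

theorem smul_balancedTmul (r : R) (x : ω) (y : N) :
    balancedTmul R S (r • x) y = r • balancedTmul R S x y := rfl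

theorem balancedTmul_smul (s : S) (x : ω) (y : N) :
    balancedTmul R S x (s • y) = balancedTmul R S (MulOpposite.op s • x) y := by
  rw [eq_comm, ← sub_eq_zero]
  simp only [balancedTmul, ← map_sub]
  exact (Submodule.Quotient.mk_eq_zero _).2 (Submodule.subset_span ⟨x, s, y, rfl⟩)

theorem balancedTmul_sum {ι : Type*} (x : ω) (J : Finset ι) (y : ι → N) :
    balancedTmul R S x (∑ j ∈ J, y j) = ∑ j ∈ J, balancedTmul R S x (y j) := by
  let φ : N →+ BalancedTensor R S ω N :=
    { toFun := balancedTmul R S x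
      map_zero' := by simp [balancedTmul]
      map_add' := balancedTmul_add x }
  exact map_sum φ y J

theorem balancedTensor_induction {p : BalancedTensor R S ω N → Prop} (t : BalancedTensor R S ω N)
    (zero : p 0) (tmul : ∀ x y, p (balancedTmul R S x y)) (add : ∀ a b, p a → p b → p (a + b)) :
    p t := by
  obtain ⟨t, rfl⟩ := (balancedRel R S ω N).mkQ_surjective t
  induction t with
  | zero => rwa [map_zero]
  | tmul x y => exact tmul x y
  | add a b ha hb => rw [map_add]; exact add _ _ ha hb

/-- The map out of `ω ⊗_S N` induced by a balanced biadditive map. -/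
def balancedLift (β : ω →ₗ[R] N →ₗ[ℤ] P)
    (h : ∀ x (s : S) y, β (MulOpposite.op s • x) y = β x (s • y)) :
    BalancedTensor R S ω N →ₗ[R] P :=
  Submodule.liftQ _ (TensorProduct.AlgebraTensorModule.lift β) (by
    rw [balancedRel, Submodule.span_le]
    rintro _ ⟨x, s, y, rfl⟩
    simp [h])

theorem balancedMap_tmul {N' : Type u} [AddCommGroup N'] [Module S N'] (f : N →ₗ[S] N') (x : ω)
    (y : N) : balancedMap R S ω f (balancedTmul R S x y) = balancedTmul R S x (f y) := rfl

end BalancedLift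

section Adjunction

variable (R S ω : Type u) [Ring R] [Ring S] [AddCommGroup ω] [Module R ω] [Module Sᵐᵒᵖ ω]
  [SMulCommClass R Sᵐᵒᵖ ω]

variable {R S ω} in
/-- The map `ω ⊗_S N → M` corresponding to `N → Hom_R(ω, M)`. -/
def balancedUncurry {N M : Type u} [AddCommGroup N] [Module S N] [AddCommGroup M] [Module R M]
    (ψ : N →ₗ[S] HomModule R ω S M) : BalancedTensor R S ω N →ₗ[R] M :=
  balancedLift
    { toFun := fun x =>
        { toFun := fun y => ψ y x
          map_add' := fun y y' => by rw [map_add]; rfl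
          map_smul' := fun n y => by rw [map_zsmul]; rfl }
      map_add' := fun x x' => LinearMap.ext fun y => map_add (ψ y) x x'
      map_smul' := fun r x => LinearMap.ext fun y => map_smul (ψ y) r x }
    (fun x s y => by
      change ψ y _ = ψ (s • y) x
      rw [ψ.map_smul]
      rfl)

variable {R S ω} in
/-- The map `N → Hom_R(ω, M)` corresponding to `ω ⊗_S N → M`. -/
def balancedCurry {N M : Type u} [AddCommGroup N] [Module S N] [AddCommGroup M] [Module R M]
    (φ : BalancedTensor R S ω N →ₗ[R] M) : N →ₗ[S] HomModule R ω S M where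
  toFun y :=
    ({ toFun := fun x => φ (balancedTmul R S x y)
       map_add' := fun x x' => by rw [add_balancedTmul, map_add]
       map_smul' := fun r x => by rw [smul_balancedTmul, map_smul]; rfl } : ω →ₗ[R] M)
  map_add' y y' := LinearMap.ext fun x => by
    change φ _ = φ _ + φ _
    rw [balancedTmul_add, map_add]
  map_smul' s y := LinearMap.ext fun x => by
    exact congrArg φ (balancedTmul_smul s x y)

/-- Tensor-hom adjunction over a noncommutative ring. -/
def tensorHomAdjunction : tensorFunctor R S ω ⊣ homFunctor R S ω :=
  Adjunction.mkOfHomEquiv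
    { homEquiv := fun _ _ =>
        { toFun := fun φ => ModuleCat.ofHom (balancedCurry φ.hom)
          invFun := fun ψ => ModuleCat.ofHom (balancedUncurry ψ.hom)
          left_inv := fun _ => ModuleCat.hom_ext (balancedTensor_hom_ext R S ω fun _ _ => rfl)
          right_inv := fun _ => rfl }
      homEquiv_naturality_left_symm := fun _ _ =>
        ModuleCat.hom_ext (balancedTensor_hom_ext R S ω fun _ _ => rfl)
      homEquiv_naturality_right := fun _ _ => rfl }

variable {R S ω}

theorem tensorHomAdjunction_unit_app (N : ModuleCat.{u} S) :
    (tensorHomAdjunction R S ω).unit.app N = ModuleCat.ofHom (balancedCurry LinearMap.id) := rfl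

theorem tensorHomAdjunction_counit_app (M : ModuleCat.{u} R) :
    (tensorHomAdjunction R S ω).counit.app M = ModuleCat.ofHom (balancedUncurry LinearMap.id) :=
  rfl

end Adjunction

/-! ### Finite syzygies and Ext into objects controlled by finitely generated sources. -/

section FinitePresentation

variable {A : Type u} [Ring A]

/-- `M` has the first `n` steps of a resolution by finitely generated projectives, with finitely
generated last syzygy. -/
def HasFiniteSyzygies : ℕ → ModuleCat.{u} A → Prop
  | 0, M => Module.Finite A M
  | n + 1, M => ∃ (K Q : ModuleCat.{u} A) (f : K ⟶ Q) (g : Q ⟶ M), ExactPair f g ∧ Mono f ∧ Epi g ∧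
      Projective Q ∧ Module.Finite A Q ∧ HasFiniteSyzygies n K

theorem HasFiniteSyzygies.finite {n : ℕ} {M : ModuleCat.{u} A} (h : HasFiniteSyzygies n M) :
    Module.Finite A M := by
  cases n with
  | zero => exact h
  | succ n =>
    obtain ⟨K, Q, f, g, -, -, hg, -, hQ, -⟩ := h
    exact Module.Finite.of_surjective g.hom ((ModuleCat.epi_iff_surjective g).1 hg)

theorem hasFiniteSyzygies_of_exactPair {M : ModuleCat.{u} A} (P : ProjectiveResolution M)
    (hP : ∀ k, Module.Finite A (P.complex.X k)) (n i : ℕ) {C : ModuleCat.{u} A}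
    (p : P.complex.X i ⟶ C) [Epi p] (h : ExactPair (P.complex.d (i + 1) i) p) :
    HasFiniteSyzygies n C := by
  induction n generalizing i C with
  | zero =>
    have := hP i
    exact Module.Finite.of_surjective p.hom ((ModuleCat.epi_iff_surjective p).1 ‹_›)
  | succ n ih =>
    have hm : Mono (Limits.cokernel.desc (P.complex.d (i + 2) (i + 1)) (P.complex.d (i + 1) i)
      (P.complex.d_comp_d _ _ _)) := (P.exact_succ i).mono_cokernelDesc
    refine ⟨Limits.cokernel (P.complex.d (i + 2) (i + 1)), P.complex.X i,
      Limits.cokernel.desc _ (P.complex.d (i + 1) i) (P.complex.d_comp_d _ _ _), p, ?_, hm, ‹_›,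
      P.projective i, hP i,
      ih (i + 1) (Limits.cokernel.π (P.complex.d (i + 2) (i + 1)))
        ⟨_, ShortComplex.exact_cokernel _⟩⟩
    rwa [← ExactPair.epi_comp_iff (Limits.cokernel.π (P.complex.d (i + 2) (i + 1))),
      Limits.cokernel.π_desc]

theorem HasDegreewiseFiniteResolution.hasFiniteSyzygies {M : Type u} [AddCommGroup M] [Module A M]
    (h : HasDegreewiseFiniteResolution A M) (n : ℕ) : HasFiniteSyzygies n (ModuleCat.of A M) := by
  obtain ⟨P, hP⟩ := h
  exact hasFiniteSyzygies_of_exactPair P hP n 0 (resolutionAugmentation P)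
    (exactPair_resolutionAugmentation P)

/-- Dimension shifting in the first variable of `Ext`. -/
theorem subsingleton_ext_syzygy {K Q M X : ModuleCat.{u} A} {f : K ⟶ Q} {g : Q ⟶ M}
    (h : ExactPair f g) [Mono f] [Epi g] [Projective Q] (i : ℕ)
    (hM : Subsingleton (Ext.{u} M X (i + 2))) : Subsingleton (Ext.{u} K X (i + 1)) := by
  refine subsingleton_of_forall_eq 0 fun e => ?_
  obtain ⟨e', rfl⟩ := Ext.contravariant_sequence_exact₁ h.shortExact X e (by omega)
    (Subsingleton.elim (α := Ext.{u} M X (i + 2)) _ _)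
  rw [Ext.eq_zero_of_projective e', Ext.comp_zero]

theorem subsingleton_ext_of_syzygy {K Q M X : ModuleCat.{u} A} {f : K ⟶ Q} {g : Q ⟶ M}
    (h : ExactPair f g) [Mono f] [Epi g] [Projective Q] (i : ℕ)
    (hK : Subsingleton (Ext.{u} K X (i + 1))) : Subsingleton (Ext.{u} M X (i + 2)) := by
  refine subsingleton_of_forall_eq 0 fun e => ?_
  obtain ⟨e', rfl⟩ := Ext.contravariant_sequence_exact₃ h.shortExact X e
    (Ext.eq_zero_of_projective _) (n₀ := i + 1) (by omega)
  rw [Subsingleton.elim e' 0, Ext.comp_zero]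

theorem exists_extension_of_subsingleton_ext {K Q M X : ModuleCat.{u} A} {f : K ⟶ Q} {g : Q ⟶ M}
    (h : ExactPair f g) [Mono f] [Epi g] (hM : Subsingleton (Ext.{u} M X 1)) (u : K ⟶ X) :
    ∃ v : Q ⟶ X, f ≫ v = u := by
  obtain ⟨e, he⟩ := Ext.contravariant_sequence_exact₁ h.shortExact X (Ext.mk₀ u) (n₁ := 1)
    (by omega) (Subsingleton.elim (α := Ext.{u} M X 1) _ _)
  obtain ⟨v, rfl⟩ := Ext.addEquiv₀.symm.surjective e
  exact ⟨v, Ext.addEquiv₀.symm.injective ((Ext.mk₀_comp_mk₀ f v).symm.trans he)⟩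

theorem subsingleton_ext_one_of_extension {K Q M X : ModuleCat.{u} A} {f : K ⟶ Q} {g : Q ⟶ M}
    (h : ExactPair f g) [Mono f] [Epi g] [Projective Q]
    (H : ∀ u : K ⟶ X, ∃ v : Q ⟶ X, f ≫ v = u) : Subsingleton (Ext.{u} M X 1) := by
  refine subsingleton_of_forall_eq 0 fun e => ?_
  obtain ⟨e', rfl⟩ := Ext.contravariant_sequence_exact₃ h.shortExact X e
    (Ext.eq_zero_of_projective _) (n₀ := 0) (by omega)
  obtain ⟨u, rfl⟩ := Ext.addEquiv₀.symm.surjective e'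
  obtain ⟨v, rfl⟩ := H u
  have h₁ : (Ext.addEquiv₀.symm (f ≫ v) : Ext.{u} K X 0) =
    (Ext.mk₀ f).comp (Ext.mk₀ v) (zero_add 0) := (Ext.mk₀_comp_mk₀ f v).symm
  rw [h₁]
  exact h.shortExact.extClass_comp_assoc _

/-- Vanishing of `Ext(M, -)` passes from `D` to objects `X` such that maps from finitely generated
modules to `X` are finite sums of maps factoring through `D`. -/
theorem subsingleton_ext_of_finite_factorization {D X : ModuleCat.{u} A}
    (hX : ∀ (K : ModuleCat.{u} A) (u : K ⟶ X), Module.Finite A K →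
      ∃ (ι : Type u) (s : Finset ι) (a : ι → (K ⟶ D)) (b : ι → (D ⟶ X)), u = ∑ j ∈ s, a j ≫ b j)
    (i : ℕ) {M : ModuleCat.{u} A} (hM : HasFiniteSyzygies (i + 1) M)
    (hD : Subsingleton (Ext.{u} M D (i + 1))) : Subsingleton (Ext.{u} M X (i + 1)) := by
  induction i generalizing M with
  | zero =>
    obtain ⟨K, Q, f, g, h, hf, hg, hQ, -, hK⟩ := hM
    refine subsingleton_ext_one_of_extension h fun u => ?_
    obtain ⟨ι, s, a, b, rfl⟩ := hX K u hK.finite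
    -- Each component `a j : K ⟶ D` extends to `Q` because `Ext^1(M, D) = 0`; hence so does the
    -- finite sum.
    choose v hv using fun j => exists_extension_of_subsingleton_ext h hD (a j)
    exact ⟨∑ j ∈ s, v j ≫ b j, by simp only [Preadditive.comp_sum, reassoc_of% hv]⟩
  | succ i ih =>
    obtain ⟨K, Q, f, g, h, hf, hg, hQ, -, hK⟩ := hM
    exact subsingleton_ext_of_syzygy h i (ih hK (subsingleton_ext_syzygy h i hD))

end FinitePresentation

/-! ### Projective `S`-modules: Ext-acyclicity of `ω ⊗ P` and the unit. -/

section Coordinates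

variable {R S W : Type u} [Ring R] [Ring S] [AddCommGroup W] [Module R W] [Module Sᵐᵒᵖ W]
  [SMulCommClass R Sᵐᵒᵖ W] {N : Type u} [AddCommGroup N] [Module S N]

/-- The coordinates of `x ⊗ y` with respect to a family of coordinates `s` on `N`. -/
noncomputable def balancedCoord (s : N →ₗ[S] N →₀ S) :
    BalancedTensor R S W N →ₗ[R] N →₀ W :=
  balancedLift
    { toFun := fun x =>
        { toFun := fun y => (s y).mapRange (fun a => MulOpposite.op a • x) (zero_smul _ _)
          map_add' := fun y y' => by
            ext z
            simp [add_smul]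
          map_smul' := fun n y => by
            ext z
            simp only [map_zsmul, Finsupp.mapRange_apply, Finsupp.smul_apply, eq_intCast, Int.cast_id]
            rw [MulOpposite.op_smul, smul_assoc] }
      map_add' := fun x x' => by
        ext y z
        simp
      map_smul' := fun r x => by
        ext y z
        simp [smul_comm] }
    (fun x a y => by
      ext z
      simp [mul_smul])

/-- The map `x ↦ x ⊗ y`. -/
def balancedTmulRight (R S : Type u) [Ring R] [Ring S] {W : Type u} [AddCommGroup W] [Module R W]
    [Module Sᵐᵒᵖ W] {N : Type u} [AddCommGroup N] [Module S N] (y : N) :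
    W →ₗ[R] BalancedTensor R S W N where
  toFun x := balancedTmul R S x y
  map_add' x x' := add_balancedTmul x x' y
  map_smul' r x := smul_balancedTmul r x y

/-- A section `s` makes `N` a summand of the free module on its own elements; correspondingly `W ⊗
N` is a summand of a direct sum of copies of `W`. -/
theorem lsum_balancedCoord (s : N →ₗ[S] N →₀ S)
    (hs : Finsupp.linearCombination S id ∘ₗ s = LinearMap.id) (t : BalancedTensor R S W N) :
    Finsupp.lsum ℕ (fun z => balancedTmulRight R S (W := W) z) (balancedCoord s t) = t := by
  induction t using balancedTensor_induction with
  | zero => simp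
  | add a b ha hb => rw [map_add, map_add, ha, hb]
  | tmul x y =>
    have hy : (s y).sum (fun z a => a • z) = y := LinearMap.congr_fun hs y
    rw [Finsupp.lsum_apply]
    change ((s y).mapRange (fun a => MulOpposite.op a • x) (zero_smul _ _)).sum _ = _
    rw [Finsupp.sum_mapRange_index (fun z => map_zero _)]
    conv_rhs => rw [← hy, Finsupp.sum, balancedTmul_sum]
    exact Finset.sum_congr rfl fun z _ => (balancedTmul_smul _ _ _).symm

end Coordinates

section ProjectiveAcyclic

variable {R S ω : Type u} [Ring R] [Ring S] [AddCommGroup ω] [Module R ω] [Module Sᵐᵒᵖ ω]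
  [SMulCommClass R Sᵐᵒᵖ ω]

/-- The coordinates of the images of finitely many generators of `K` involve only finitely many
indices, which then serve all of `K`. -/
theorem exists_finite_factorization {P : Type u} [AddCommGroup P] [Module S P]
    [hP : Module.Projective S P]
    {K : Type u} [AddCommGroup K] [Module R K] [hK : Module.Finite R K]
    (u : K →ₗ[R] BalancedTensor R S ω P) :
    ∃ (J : Finset P) (a : P → (K →ₗ[R] ω)), ∀ x, u x = ∑ z ∈ J, balancedTmul R S (a z x) z := by
  classical
  obtain ⟨s, hs⟩ := Module.projective_def'.1 hP
  obtain ⟨G, hG⟩ := hK.fg_top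
  let v : K →ₗ[R] P →₀ ω := balancedCoord s ∘ₗ u
  refine ⟨G.biUnion fun g => (v g).support, fun z => Finsupp.lapply z ∘ₗ v, fun x => ?_⟩
  have hx : v x ∈ Finsupp.supported ω R (↑(G.biUnion fun g => (v g).support) : Set P) := by
    have h : (⊤ : Submodule R K) ≤ (Finsupp.supported ω R
        (↑(G.biUnion fun g => (v g).support) : Set P)).comap v := by
      rw [← hG, Submodule.span_le]
      intro g hg
      exact (Finsupp.mem_supported R (v g)).2
        (Finset.coe_subset.2 (Finset.subset_biUnion_of_mem (fun g => (v g).support) hg))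
    exact h Submodule.mem_top
  conv_lhs => rw [← lsum_balancedCoord s hs (u x), Finsupp.lsum_apply]
  exact Finsupp.sum_of_support_subset _ (Finset.coe_subset.1 ((Finsupp.mem_supported R _).1 hx)) _
    fun z _ => map_zero _

theorem subsingleton_ext_tensor_projective (hω : IsSemidualizing R S ω) (P : ModuleCat.{u} S)
    [Projective P] (i : ℕ) :
    Subsingleton (Ext.{u} (ModuleCat.of R ω) ((tensorFunctor R S ω).obj P) (i + 1)) := by
  have : Module.Projective S P := (IsProjective.iff_projective P).2 inferInstance
  refine subsingleton_ext_of_finite_factorization (D := ModuleCat.of R ω) (fun K u hK => ?_) i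
    (hω.finite_left.hasFiniteSyzygies _) (hω.ext_left _ (by omega))
  obtain ⟨J, a, h⟩ := exists_finite_factorization (S := S) (ω := ω) (P := P) u.hom
  refine ⟨P, J, fun z => ModuleCat.ofHom (a z), fun z => ModuleCat.ofHom (balancedTmulRight R S z),
    ?_⟩
  ext x
  rw [ModuleCat.hom_sum, LinearMap.sum_apply]
  exact h x

/-- Coordinatewise this is the homothety `S → Hom_R(ω, ω)`: its injectivity kills the coordinates of
an element of the kernel, and its surjectivity replaces each component `ω → ω` of `g` by a scalar.
Finite generation of `ω` makes the components finite in number. -/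
theorem isIso_unit_projective (hω : IsSemidualizing R S ω) (P : ModuleCat.{u} S) [Projective P] :
    IsIso ((tensorHomAdjunction R S ω).unit.app P) := by
  have : Module.Projective S P := (IsProjective.iff_projective P).2 inferInstance
  have hfin : Module.Finite R ω := (hω.finite_left.hasFiniteSyzygies 0).finite
  rw [ConcreteCategory.isIso_iff_bijective, tensorHomAdjunction_unit_app]
  obtain ⟨s, hs⟩ := Module.projective_def'.1 this
  constructor
  · refine (injective_iff_map_eq_zero (balancedCurry (R := R) (S := S) (ω := ω)
      (LinearMap.id : BalancedTensor R S ω P →ₗ[R] _))).2 fun y hy => ?_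
    have h : ∀ x : ω, balancedTmul R S x y = 0 := fun x => LinearMap.congr_fun hy x
    have hsy : s y = 0 := by
      ext z
      apply hω.homothety_right.1
      ext x
      have := DFunLike.congr_fun (congrArg (balancedCoord s) (h x)) z
      rw [map_zero] at this
      exact this.trans (zero_smul Sᵐᵒᵖ x).symm
    have := LinearMap.congr_fun hs y
    rw [LinearMap.comp_apply, hsy, map_zero] at this
    exact this.symm
  · intro (g : HomModule R ω S (BalancedTensor R S ω P))
    obtain ⟨J, a, h⟩ := exists_finite_factorization g.toLinearMap
    choose c hc using fun z => hω.homothety_right.2 (a z)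
    refine ⟨∑ z ∈ J, c z • z, LinearMap.ext fun x => ?_⟩
    refine Eq.trans ?_ (h x).symm
    change balancedTmul R S x (∑ z ∈ J, c z • z) = _
    rw [balancedTmul_sum]
    refine Finset.sum_congr rfl fun z _ => ?_
    rw [balancedTmul_smul, ← hc z]
    rfl

end ProjectiveAcyclic

/-! ### Tensor products as functors of the right module, without an `R`-action. -/

section TensorLeft

/-- The integers in the universe `u`, over which tensor products of one-sided modules are formed. -/
abbrev LiftInt : Type u := ULift.{u} ℤ

instance smulCommClass_liftInt {A M : Type*} [Ring A] [AddCommGroup M] [Module A M] :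
    SMulCommClass LiftInt.{u} A M where
  smul_comm n a m := smul_comm n.down a m

variable {S : Type u} [Ring S] {K Q W : Type u} [AddCommGroup K] [Module Sᵐᵒᵖ K]
  [AddCommGroup Q] [Module Sᵐᵒᵖ Q] [AddCommGroup W] [Module Sᵐᵒᵖ W]
  {N N' N'' : Type u} [AddCommGroup N] [Module S N] [AddCommGroup N'] [Module S N']
  [AddCommGroup N''] [Module S N'']

variable (N) in
/-- The map `f ⊗_S N`. -/
def balancedMapLeft (f : K →ₗ[Sᵐᵒᵖ] Q) :
    BalancedTensor LiftInt.{u} S K N →ₗ[LiftInt.{u}] BalancedTensor LiftInt.{u} S Q N :=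
  balancedLift
    { toFun := fun x =>
        { toFun := fun y => balancedTmul LiftInt S (f x) y
          map_add' := balancedTmul_add (f x)
          map_smul' := fun n y =>
            map_zsmul (AddMonoidHom.mk' (balancedTmul LiftInt S (f x)) (balancedTmul_add (f x))) n y }
      map_add' := fun x x' => LinearMap.ext fun y => by
        change balancedTmul LiftInt S (f (x + x')) y = _
        rw [map_add, add_balancedTmul]; rfl
      map_smul' := fun n x => LinearMap.ext fun y => by
        change balancedTmul LiftInt S (f (n.down • x)) y = _
        rw [map_zsmul]; rfl }
    (fun x s y => by
      change balancedTmul LiftInt S (f (MulOpposite.op s • x)) y =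
        balancedTmul LiftInt S (f x) (s • y)
      rw [balancedTmul_smul, map_smul])

theorem balancedMapLeft_tmul (f : K →ₗ[Sᵐᵒᵖ] Q) (x : K) (y : N) :
    balancedMapLeft N f (balancedTmul LiftInt S x y) = balancedTmul LiftInt S (f x) y := rfl

theorem balancedMapLeft_balancedMap (f : K →ₗ[Sᵐᵒᵖ] Q) (g : N →ₗ[S] N')
    (t : BalancedTensor LiftInt.{u} S K N) :
    balancedMapLeft N' f (balancedMap LiftInt S K g t) =
      balancedMap LiftInt S Q g (balancedMapLeft N f t) := by
  induction t using balancedTensor_induction with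
  | zero => simp only [map_zero]
  | tmul x y => rfl
  | add a b ha hb => simp only [map_add, ha, hb]

theorem balancedMapLeft_comp_eq_zero {f : K →ₗ[Sᵐᵒᵖ] Q} {g : Q →ₗ[Sᵐᵒᵖ] W}
    (h : Function.Exact f g) (t : BalancedTensor LiftInt.{u} S K N) :
    balancedMapLeft N g (balancedMapLeft N f t) = 0 := by
  induction t using balancedTensor_induction with
  | zero => simp only [map_zero]
  | tmul x y =>
    rw [balancedMapLeft_tmul, balancedMapLeft_tmul, h.apply_apply_eq_zero]
    exact map_zero (balancedTmulRight LiftInt S y)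
  | add a b ha hb => simp only [map_add, ha, hb, add_zero]

theorem balancedMapLeft_surjective {g : Q →ₗ[Sᵐᵒᵖ] W} (h : Function.Surjective g) :
    Function.Surjective (balancedMapLeft N g) := by
  intro t
  induction t using balancedTensor_induction with
  | zero => exact ⟨0, map_zero _⟩
  | tmul x y =>
    obtain ⟨x, rfl⟩ := h x
    exact ⟨_, balancedMapLeft_tmul g x y⟩
  | add a b ha hb =>
    obtain ⟨a, rfl⟩ := ha
    obtain ⟨b, rfl⟩ := hb
    exact ⟨a + b, map_add _ _ _⟩

theorem exists_mapRange_eq {ι A B C : Type*} [Zero A] [Zero B] [Zero C] {f : A → B} {g : B → C}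
    (hf : f 0 = 0) (hg : g 0 = 0) (h : Function.Exact f g) (v : ι →₀ B)
    (hv : v.mapRange g hg = 0) : ∃ w : ι →₀ A, w.mapRange f hf = v := by
  classical
  have h' : ∀ i, ∃ a, f a = v i := fun i => (h (v i)).1 (DFunLike.congr_fun hv i)
  choose a ha using h'
  -- The chosen preimage of `0` may be nonzero, so it is reset to `0` off the support.
  refine ⟨Finsupp.onFinset v.support (fun i => if v i = 0 then 0 else a i) fun i hi => ?_, ?_⟩
  · rw [Finsupp.mem_support_iff]
    intro h0
    exact hi (if_pos h0)
  · ext i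
    rw [Finsupp.mapRange_apply, Finsupp.onFinset_apply]
    split_ifs with h0
    · rw [h0, hf]
    · exact ha i

section ProjectiveRight

theorem balancedCoord_balancedMapLeft (s : N →ₗ[S] N →₀ S) (f : K →ₗ[Sᵐᵒᵖ] Q)
    (t : BalancedTensor LiftInt.{u} S K N) :
    balancedCoord s (balancedMapLeft N f t) =
      (balancedCoord s t).mapRange f (map_zero f) := by
  induction t using balancedTensor_induction with
  | zero => rw [map_zero, map_zero, map_zero, Finsupp.mapRange_zero]
  | tmul x y =>
    ext z
    exact (map_smul f _ _).symm
  | add a b ha hb =>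
    rw [map_add, map_add, ha, hb, map_add, Finsupp.mapRange_add (map_add _)]

theorem lsum_balancedTmulRight_mapRange (f : K →ₗ[Sᵐᵒᵖ] Q) (v : N →₀ K) :
    Finsupp.lsum ℕ (fun z => balancedTmulRight LiftInt.{u} S (W := Q) z)
        (v.mapRange f (map_zero f)) =
      balancedMapLeft N f (Finsupp.lsum ℕ (fun z => balancedTmulRight LiftInt S (W := K) z) v) := by
  rw [Finsupp.lsum_apply, Finsupp.lsum_apply, Finsupp.sum_mapRange_index (fun z => map_zero _),
    Finsupp.sum, Finsupp.sum, map_sum]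
  rfl

theorem balancedMapLeft_injective [hN : Module.Projective S N] {f : K →ₗ[Sᵐᵒᵖ] Q}
    (h : Function.Injective f) : Function.Injective (balancedMapLeft N f) := by
  obtain ⟨s, hs⟩ := Module.projective_def'.1 hN
  refine (injective_iff_map_eq_zero _).2 fun t ht => ?_
  have h₁ := balancedCoord_balancedMapLeft s f t
  rw [ht, map_zero] at h₁
  rw [← lsum_balancedCoord s hs t]
  refine (congrArg _ (Finsupp.ext fun z => ?_)).trans (map_zero _)
  exact h ((DFunLike.congr_fun h₁ z).symm.trans (map_zero f).symm)

theorem balancedMapLeft_exact [hN : Module.Projective S N] {f : K →ₗ[Sᵐᵒᵖ] Q}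
    {g : Q →ₗ[Sᵐᵒᵖ] W} (h : Function.Exact f g) :
    Function.Exact (balancedMapLeft N f) (balancedMapLeft N g) := by
  obtain ⟨s, hs⟩ := Module.projective_def'.1 hN
  refine fun t => ⟨fun ht => ?_, ?_⟩
  · obtain ⟨v, hv⟩ := exists_mapRange_eq (map_zero f) (map_zero g) h
      (balancedCoord s t) (by rw [← balancedCoord_balancedMapLeft, ht, map_zero])
    exact ⟨_, by rw [← lsum_balancedTmulRight_mapRange, hv, lsum_balancedCoord s hs]⟩
  · rintro ⟨t, rfl⟩
    exact balancedMapLeft_comp_eq_zero h t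

end ProjectiveRight

section ProjectiveLeft

/-- The coordinates of `x ⊗ y` with respect to a family of coordinates `s` on `Q`. -/
noncomputable def balancedCoordLeft (s : Q →ₗ[Sᵐᵒᵖ] Q →₀ Sᵐᵒᵖ) :
    BalancedTensor LiftInt.{u} S Q N →ₗ[LiftInt.{u}] Q →₀ N :=
  balancedLift
    { toFun := fun x =>
        { toFun := fun y => (s x).mapRange (fun a => a.unop • y) (zero_smul _ _)
          map_add' := fun y y' => by
            ext z
            simp
          map_smul' := fun n y => by
            ext z
            exact smul_comm _ n y }
      map_add' := fun x x' => by
        ext y z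
        simp [add_smul]
      map_smul' := fun n x => by
        ext y z
        change (s (n.down • x) z).unop • y = n.down • (s x z).unop • y
        rw [map_zsmul, ← smul_assoc]
        rfl }
    (fun x a y => by
      ext z
      simp [mul_smul])

variable (N) in
/-- The additive map sending a family `y` of elements of `N` to the sum of the `z ⊗ y z`. -/
noncomputable def balancedSumLeft (Q : Type u) [AddCommGroup Q] [Module Sᵐᵒᵖ Q] :
    (Q →₀ N) →+ BalancedTensor LiftInt.{u} S Q N :=
  Finsupp.liftAddHom fun z => AddMonoidHom.mk' (balancedTmul LiftInt S z) (balancedTmul_add z)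

theorem balancedSumLeft_balancedCoordLeft (s : Q →ₗ[Sᵐᵒᵖ] Q →₀ Sᵐᵒᵖ)
    (hs : Finsupp.linearCombination Sᵐᵒᵖ id ∘ₗ s = LinearMap.id)
    (t : BalancedTensor LiftInt.{u} S Q N) :
    balancedSumLeft N Q (balancedCoordLeft s t) = t := by
  induction t using balancedTensor_induction with
  | zero => simp
  | add a b ha hb => rw [map_add, map_add, ha, hb]
  | tmul x y =>
    have hx : (s x).sum (fun z a => a • z) = x := LinearMap.congr_fun hs x
    rw [balancedSumLeft, Finsupp.liftAddHom_apply]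
    change ((s x).mapRange (fun a => a.unop • y) (zero_smul _ _)).sum _ = _
    rw [Finsupp.sum_mapRange_index (fun z => map_zero _)]
    conv_rhs =>
      rw [← hx, Finsupp.sum]
      change balancedTmulRight LiftInt S y _
      rw [map_sum]
    exact Finset.sum_congr rfl fun z _ => balancedTmul_smul _ _ _

theorem balancedCoordLeft_balancedMap (s : Q →ₗ[Sᵐᵒᵖ] Q →₀ Sᵐᵒᵖ) (f : N →ₗ[S] N')
    (t : BalancedTensor LiftInt.{u} S Q N) :
    balancedCoordLeft s (balancedMap LiftInt S Q f t) =
      (balancedCoordLeft s t).mapRange f (map_zero f) := by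
  induction t using balancedTensor_induction with
  | zero => rw [map_zero, map_zero, map_zero, Finsupp.mapRange_zero]
  | tmul x y =>
    ext z
    exact (map_smul f _ _).symm
  | add a b ha hb =>
    rw [map_add, map_add, ha, hb, map_add, Finsupp.mapRange_add (map_add _)]

theorem balancedSumLeft_mapRange (f : N →ₗ[S] N') (v : Q →₀ N) :
    balancedSumLeft N' Q (v.mapRange f (map_zero f)) =
      balancedMap LiftInt.{u} S Q f (balancedSumLeft N Q v) := by
  rw [balancedSumLeft, balancedSumLeft, Finsupp.liftAddHom_apply, Finsupp.liftAddHom_apply,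
    Finsupp.sum_mapRange_index (fun z => map_zero _), Finsupp.sum, Finsupp.sum, map_sum]
  rfl

theorem balancedMap_comp_eq_zero {f : N →ₗ[S] N'} {g : N' →ₗ[S] N''}
    (h : Function.Exact f g) (t : BalancedTensor LiftInt.{u} S W N) :
    balancedMap LiftInt S W g (balancedMap LiftInt S W f t) = 0 := by
  induction t using balancedTensor_induction with
  | zero => simp only [map_zero]
  | tmul x y =>
    rw [balancedMap_tmul, balancedMap_tmul, h.apply_apply_eq_zero]
    exact map_zero (AddMonoidHom.mk' (balancedTmul LiftInt.{u} S x) (balancedTmul_add x))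
  | add a b ha hb => simp only [map_add, ha, hb, add_zero]

theorem balancedMap_exact_of_projective [hQ : Module.Projective Sᵐᵒᵖ Q] {f : N →ₗ[S] N'}
    {g : N' →ₗ[S] N''} (h : Function.Exact f g) :
    Function.Exact (balancedMap LiftInt.{u} S Q f) (balancedMap LiftInt.{u} S Q g) := by
  obtain ⟨s, hs⟩ := Module.projective_def'.1 hQ
  refine fun t => ⟨fun ht => ?_, ?_⟩
  · obtain ⟨v, hv⟩ := exists_mapRange_eq (map_zero f) (map_zero g) h
      (balancedCoordLeft s t) (by rw [← balancedCoordLeft_balancedMap, ht, map_zero])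
    exact ⟨_, by rw [← balancedSumLeft_mapRange, hv, balancedSumLeft_balancedCoordLeft s hs]⟩
  · rintro ⟨t, rfl⟩
    exact balancedMap_comp_eq_zero h t

end ProjectiveLeft

/-- Dimension shifting in the first variable of `Tor`: exactness of `W ⊗ -` at `A₂` follows from
exactness of `K ⊗ -` at `A₁`, where `K` is a syzygy of `W`. -/
theorem balancedMap_exact_of_syzygy {f : K →ₗ[Sᵐᵒᵖ] Q} {g : Q →ₗ[Sᵐᵒᵖ] W}
    (h : Function.Exact f g) (hg : Function.Surjective g) [Module.Projective Sᵐᵒᵖ Q]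
    {A₀ A₁ A₂ A₃ : Type u} [AddCommGroup A₀] [Module S A₀] [AddCommGroup A₁] [Module S A₁]
    [AddCommGroup A₂] [Module S A₂] [AddCommGroup A₃] [Module S A₃] [Module.Projective S A₁]
    {a : A₃ →ₗ[S] A₂} {b : A₂ →ₗ[S] A₁} {c : A₁ →ₗ[S] A₀} (hab : Function.Exact a b)
    (hbc : Function.Exact b c) (hA₀ : Function.Injective (balancedMapLeft A₀ f))
    (hK : Function.Exact (balancedMap LiftInt.{u} S K b) (balancedMap LiftInt.{u} S K c)) :
    Function.Exact (balancedMap LiftInt.{u} S W a) (balancedMap LiftInt.{u} S W b) := by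
  refine fun t => ⟨fun ht => ?_, ?_⟩
  · obtain ⟨t, rfl⟩ := balancedMapLeft_surjective hg t
    rw [← balancedMapLeft_balancedMap] at ht
    -- Lift to `Q ⊗ A₂` and push to `Q ⊗ A₁`: the result comes from some `k` in `K ⊗ A₁`, and `k`
    -- dies in `K ⊗ A₀` by injectivity, so it comes from `K ⊗ A₂`. Subtracting that correction gives
    -- a cycle over the flat module `Q`.
    obtain ⟨k, hk⟩ := (balancedMapLeft_exact h _).1 ht
    obtain ⟨k, rfl⟩ := (hK k).1 (hA₀ (by
      rw [balancedMapLeft_balancedMap, hk, balancedMap_comp_eq_zero hbc, map_zero]))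
    rw [balancedMapLeft_balancedMap] at hk
    obtain ⟨q, hq⟩ := (balancedMap_exact_of_projective (Q := Q) hab
      (t - balancedMapLeft A₂ f k)).1 (by rw [map_sub, hk, sub_self])
    refine ⟨balancedMapLeft A₃ g q, ?_⟩
    rw [← balancedMapLeft_balancedMap, hq, map_sub, balancedMapLeft_comp_eq_zero h, sub_zero]
  · rintro ⟨t, rfl⟩
    exact balancedMap_comp_eq_zero hab t

end TensorLeft

theorem exists_extension_of_ker_le {R : Type u} [Ring R] {A B I : Type u} [AddCommGroup A]
    [Module R A] [AddCommGroup B] [Module R B] [AddCommGroup I] [Module R I] [Module.Injective R I]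
    (α : A →ₗ[R] B) (θ : A →ₗ[R] I) (h : ∀ a, α a = 0 → θ a = 0) :
    ∃ θ' : B →ₗ[R] I, ∀ a, θ' (α a) = θ a := by
  obtain ⟨θ', hθ'⟩ := Module.Injective.out ((LinearMap.ker α).liftQ α le_rfl)
    (LinearMap.ker_eq_bot.1 (Submodule.ker_liftQ_eq_bot _ _ _ le_rfl))
    ((LinearMap.ker α).liftQ θ fun a ha => h a ha)
  exact ⟨θ', fun a => hθ' ((LinearMap.ker α).mkQ a)⟩

/-! ### The evaluation map on `W ⊗ Hom_R(ω, I)`. -/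

section Evaluation

variable {R S ω : Type u} [Ring R] [Ring S] [AddCommGroup ω] [Module R ω] [Module Sᵐᵒᵖ ω]
  [SMulCommClass R Sᵐᵒᵖ ω] [SMulCommClass Sᵐᵒᵖ R ω]
  {K Q W : Type u} [AddCommGroup K] [Module Sᵐᵒᵖ K]
  [AddCommGroup Q] [Module Sᵐᵒᵖ Q] [AddCommGroup W] [Module Sᵐᵒᵖ W]
  {I : Type u} [AddCommGroup I] [Module R I]

/-- The evaluation `W ⊗_S Hom_R(ω, I) → Hom_R(Hom_{Sᵐᵒᵖ}(W, ω), I)`, sending `x ⊗ φ` to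
`u ↦ φ (u x)`. -/
def tensorEvaluation :
    BalancedTensor LiftInt.{u} S W (HomModule R ω S I) →ₗ[LiftInt.{u}]
      ((W →ₗ[Sᵐᵒᵖ] ω) →ₗ[R] I) :=
  balancedLift
    { toFun := fun x =>
        { toFun := fun φ =>
            { toFun := fun v => φ (v x)
              map_add' := fun v v' => map_add φ (v x) (v' x)
              map_smul' := fun r v => map_smul φ r (v x) }
          map_add' := fun φ φ' => rfl
          map_smul' := fun n φ => rfl }
      map_add' := fun x x' => by
        ext φ v
        change φ (v (x + x')) = φ (v x) + φ (v x')
        rw [map_add, map_add]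
      map_smul' := fun n x => by
        ext φ v
        change φ (v (n.down • x)) = n.down • φ (v x)
        rw [map_zsmul, map_zsmul] }
    (fun x s φ => by
      ext v
      change φ (v (MulOpposite.op s • x)) = φ (MulOpposite.op s • v x)
      rw [map_smul])

theorem tensorEvaluation_balancedMapLeft (f : K →ₗ[Sᵐᵒᵖ] Q)
    (t : BalancedTensor LiftInt.{u} S K (HomModule R ω S I)) (v : Q →ₗ[Sᵐᵒᵖ] ω) :
    tensorEvaluation (balancedMapLeft _ f t) v = tensorEvaluation t (v ∘ₗ f) := by
  induction t using balancedTensor_induction with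
  | zero => simp only [map_zero, LinearMap.zero_apply]
  | tmul x y => rfl
  | add a b ha hb => simp only [map_add, LinearMap.add_apply, ha, hb]

/-- Finitely many generators embed `Hom(W, ω)` into a power of `ω`. By injectivity `θ` extends to
that power, and its components there are the second tensor factors. -/
theorem tensorEvaluation_surjective [hW : Module.Finite Sᵐᵒᵖ W] [Module.Injective R I] :
    Function.Surjective (tensorEvaluation (R := R) (S := S) (ω := ω) (W := W) (I := I)) := by
  classical
  intro θ
  obtain ⟨J, hJ⟩ := hW.fg_top
  let α : (W →ₗ[Sᵐᵒᵖ] ω) →ₗ[R] (J → ω) :=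
    { toFun := fun v j => v j
      map_add' := fun _ _ => rfl
      map_smul' := fun _ _ => rfl }
  obtain ⟨θ', hθ'⟩ := exists_extension_of_ker_le α θ fun v hv => by
    have hv : v = 0 := LinearMap.ext_on hJ fun j hj => congrFun hv ⟨j, hj⟩
    rw [hv, map_zero]
  refine ⟨∑ j : J, balancedTmul LiftInt S (j : W)
    (show HomModule R ω S I from θ' ∘ₗ LinearMap.single R (fun _ => ω) j), ?_⟩
  ext v
  rw [map_sum, LinearMap.sum_apply, ← hθ']
  change ∑ j : J, θ' (Pi.single j (α v j)) = _
  rw [← map_sum, Finset.univ_sum_single]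

theorem tensorEvaluation_injective_of_projective [hQ : Module.Projective Sᵐᵒᵖ Q] :
    Function.Injective (tensorEvaluation (R := R) (S := S) (ω := ω) (W := Q) (I := I)) := by
  obtain ⟨s, hs⟩ := Module.projective_def'.1 hQ
  refine (injective_iff_map_eq_zero _).2 fun t ht => ?_
  let v : Q → ω → (Q →ₗ[Sᵐᵒᵖ] ω) := fun q w =>
    LinearMap.toSpanSingleton Sᵐᵒᵖ ω w ∘ₗ Finsupp.lapply q ∘ₗ s
  have h : ∀ (t : BalancedTensor LiftInt.{u} S Q (HomModule R ω S I)) (q : Q) (w : ω),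
      tensorEvaluation t (v q w) = (balancedCoordLeft s t q : HomModule R ω S I) w := by
    intro t q w
    induction t using balancedTensor_induction with
    | zero => simp only [map_zero]; rfl
    | tmul x y => rfl
    | add a b ha hb => rw [map_add, LinearMap.add_apply, ha, hb, map_add]; rfl
  rw [← balancedSumLeft_balancedCoordLeft s hs t]
  refine (congrArg _ (Finsupp.ext fun q => LinearMap.ext fun w => ?_)).trans (map_zero _)
  refine (h t q w).symm.trans ?_
  rw [ht]
  rfl

/-- Lift `t` to `Q`. Its evaluation kills maps vanishing on `K`, since these factor through `W`; so
it factors through restriction to `K`, and surjectivity there yields `k`. Injectivity for `Q` shows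
that the lift is the image of `k`, which dies in `W`. -/
theorem tensorEvaluation_injective [Module.Finite Sᵐᵒᵖ K] [Module.Projective Sᵐᵒᵖ Q]
    [Module.Injective R I] {f : K →ₗ[Sᵐᵒᵖ] Q} {g : Q →ₗ[Sᵐᵒᵖ] W} (h : Function.Exact f g)
    (hg : Function.Surjective g) :
    Function.Injective (tensorEvaluation (R := R) (S := S) (ω := ω) (W := W) (I := I)) := by
  refine (injective_iff_map_eq_zero _).2 fun t ht => ?_
  obtain ⟨t, rfl⟩ := balancedMapLeft_surjective hg t
  let α : (Q →ₗ[Sᵐᵒᵖ] ω) →ₗ[R] (K →ₗ[Sᵐᵒᵖ] ω) :=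
    { toFun := fun v => v ∘ₗ f
      map_add' := fun _ _ => rfl
      map_smul' := fun _ _ => rfl }
  obtain ⟨θ', hθ'⟩ := exists_extension_of_ker_le α (tensorEvaluation t) fun v hv => by
    obtain ⟨w, rfl⟩ : ∃ w : W →ₗ[Sᵐᵒᵖ] ω, w ∘ₗ g = v := by
      refine ⟨((LinearMap.ker g).liftQ v fun q hq => ?_) ∘ₗ
        (g.quotKerEquivOfSurjective hg).symm.toLinearMap, ?_⟩
      · obtain ⟨k, rfl⟩ := (h q).1 hq
        exact LinearMap.congr_fun hv k
      · ext q
        have : (g.quotKerEquivOfSurjective hg).symm (g q) = (LinearMap.ker g).mkQ q := by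
          rw [LinearEquiv.symm_apply_eq]
          rfl
        simp only [LinearMap.comp_apply, LinearEquiv.coe_coe, this]
        rfl
    rw [← tensorEvaluation_balancedMapLeft, ht, LinearMap.zero_apply]
  obtain ⟨k, rfl⟩ := tensorEvaluation_surjective θ'
  have hk : balancedMapLeft _ f k = t := by
    apply tensorEvaluation_injective_of_projective
    ext v
    rw [tensorEvaluation_balancedMapLeft]
    exact hθ' v
  rw [← hk, balancedMapLeft_comp_eq_zero h]

/-- Evaluations of elements over `K` are determined by maps `K → ω`, all of which extend to `Q`.
This is how `Ext^1(W, ω) = 0` yields `Tor_1(W, Hom_R(ω, I)) = 0`. -/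
theorem balancedMapLeft_homModule_injective {f : K →ₗ[Sᵐᵒᵖ] Q}
    (hK : Function.Injective (tensorEvaluation (R := R) (S := S) (ω := ω) (W := K) (I := I)))
    (h : ∀ v : K →ₗ[Sᵐᵒᵖ] ω, ∃ w : Q →ₗ[Sᵐᵒᵖ] ω, w ∘ₗ f = v) :
    Function.Injective (balancedMapLeft (HomModule R ω S I) f) := by
  refine (injective_iff_map_eq_zero _).2 fun t ht => ?_
  apply hK
  ext v
  obtain ⟨w, rfl⟩ := h v
  rw [← tensorEvaluation_balancedMapLeft, ht]
  simp only [map_zero, LinearMap.zero_apply]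

end Evaluation

/-! ### Injective `R`-modules: Tor-acyclicity of `Hom_R(ω, I)` and the counit. -/

section InjectiveAcyclic

theorem ExactPair.function_exact {A : Type u} [Ring A] {X Y Z : ModuleCat.{u} A} {f : X ⟶ Y}
    {g : Y ⟶ Z} (h : ExactPair f g) : Function.Exact f.hom g.hom :=
  (ShortComplex.ShortExact.moduleCat_exact_iff_function_exact _).1 h.2

theorem balancedMap_exact_of_surjective {S : Type u} [Ring S] {W : Type u} [AddCommGroup W]
    [Module Sᵐᵒᵖ W] {X Y Z : ModuleCat.{u} S} {f : X ⟶ Y} {g : Y ⟶ Z} (h : ExactPair f g) [Epi g] :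
    Function.Exact (balancedMap LiftInt.{u} S W f.hom) (balancedMap LiftInt.{u} S W g.hom) := by
  have : (tensorFunctor LiftInt.{u} S W).IsLeftAdjoint := (tensorHomAdjunction _ _ _).isLeftAdjoint
  exact ExactPair.function_exact
    ⟨_, h.2.map_of_epi_of_preservesCokernel (tensorFunctor LiftInt.{u} S W) ‹_› inferInstance⟩

variable {R S ω : Type u} [Ring R] [Ring S] [AddCommGroup ω] [Module R ω] [Module Sᵐᵒᵖ ω]
  [SMulCommClass R Sᵐᵒᵖ ω]

/-- The statement is `Tor_(i+1)(W, Hom_R(ω, I)) = 0`. Passing to syzygies of `W` lowers `i` and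
preserves the Ext vanishing. Syzygies of `ω` need not carry an `R`-action, whence the tensor
products over `LiftInt`. -/
theorem balancedMap_exact_of_ext_vanishing [SMulCommClass Sᵐᵒᵖ R ω] {I : ModuleCat.{u} R}
    [Module.Injective R I] (P : ProjectiveResolution ((homFunctor R S ω).obj I)) (i : ℕ)
    {W : ModuleCat.{u} Sᵐᵒᵖ} (hW : HasFiniteSyzygies (i + 2) W)
    (h : ∀ j, 1 ≤ j → Subsingleton (Ext.{u} W (ModuleCat.of Sᵐᵒᵖ ω) j)) :
    Function.Exact (balancedMap LiftInt.{u} S W (P.complex.d (i + 2) (i + 1)).hom)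
      (balancedMap LiftInt.{u} S W (P.complex.d (i + 1) i).hom) := by
  have hP : ∀ k, Module.Projective S (P.complex.X k) := fun k =>
    (IsProjective.iff_projective _).2 (P.projective k)
  induction i generalizing W with
  | zero =>
    obtain ⟨K, Q, f, g, e, hf, hg, hQ, -, hK⟩ := hW
    have : Module.Projective Sᵐᵒᵖ Q := (IsProjective.iff_projective Q).2 hQ
    refine balancedMap_exact_of_syzygy e.function_exact ((ModuleCat.epi_iff_surjective g).1 hg)
      ((ExactPair.of_exact (P.exact_succ 0)).function_exact)
      (exactPair_resolutionAugmentation P).function_exact ?_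
      (balancedMap_exact_of_surjective (exactPair_resolutionAugmentation P))
    refine balancedMapLeft_homModule_injective ?_ fun v => ?_
    · obtain ⟨K', Q', f', g', e', -, hg', hQ', -, hK'⟩ := hK
      have : Module.Projective Sᵐᵒᵖ Q' := (IsProjective.iff_projective Q').2 hQ'
      have := hK'.finite
      exact tensorEvaluation_injective e'.function_exact ((ModuleCat.epi_iff_surjective g').1 hg')
    · obtain ⟨w, hw⟩ := exists_extension_of_subsingleton_ext e (h 1 le_rfl) (ModuleCat.ofHom v)
      exact ⟨w.hom, congrArg ModuleCat.Hom.hom hw⟩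
  | succ i ih =>
    obtain ⟨K, Q, f, g, e, hf, hg, hQ, -, hK⟩ := hW
    have : Module.Projective Sᵐᵒᵖ Q := (IsProjective.iff_projective Q).2 hQ
    refine balancedMap_exact_of_syzygy e.function_exact ((ModuleCat.epi_iff_surjective g).1 hg)
      ((ExactPair.of_exact (P.exact_succ (i + 1))).function_exact)
      ((ExactPair.of_exact (P.exact_succ i)).function_exact)
      (balancedMapLeft_injective ((ModuleCat.mono_iff_injective f).1 hf))
      (ih hK fun j hj => ?_)
    obtain ⟨j, rfl⟩ := Nat.exists_eq_add_of_le' hj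
    exact subsingleton_ext_syzygy e j (h _ (by omega))

theorem mem_balancedRel_iff {N : Type u} [AddCommGroup N] [Module S N] (t : ω ⊗[ℤ] N) :
    t ∈ balancedRel LiftInt.{u} S ω N ↔ t ∈ balancedRel R S ω N := by
  constructor
  · intro h
    refine Submodule.span_induction (fun x hx => Submodule.subset_span hx) (zero_mem _)
      (fun x y _ _ hx hy => add_mem hx hy) (fun n x _ hx => ?_) h
    exact zsmul_mem hx n.down
  · intro h
    refine Submodule.span_induction (fun x hx => Submodule.subset_span hx) (zero_mem _)
      (fun x y _ _ hx hy => add_mem hx hy) (fun r x _ hx => ?_) h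
    refine Submodule.span_induction (p := fun x _ => r • x ∈ balancedRel LiftInt.{u} S ω N)
      ?_ ?_ ?_ ?_ hx
    · rintro _ ⟨x, s, y, rfl⟩
      refine Submodule.subset_span ⟨r • x, s, y, ?_⟩
      rw [smul_sub, TensorProduct.smul_tmul', TensorProduct.smul_tmul', smul_comm]
    · rw [smul_zero]
      exact zero_mem _
    · intro x y _ _ hx hy
      rw [smul_add]
      exact add_mem hx hy
    · intro n x _ hx
      have h₁ := zsmul_mem hx n.down
      rwa [smul_comm] at h₁

variable (R S ω) in
/-- The tensor product does not depend on the ring acting on the left of `ω`. -/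
noncomputable def balancedTensorAddEquiv (N : Type u) [AddCommGroup N] [Module S N] :
    BalancedTensor LiftInt.{u} S ω N ≃+ BalancedTensor R S ω N :=
  QuotientAddGroup.congr (balancedRel LiftInt.{u} S ω N).toAddSubgroup
    (balancedRel R S ω N).toAddSubgroup (AddEquiv.refl _) (by
      ext t
      simpa using mem_balancedRel_iff t)

theorem balancedTensorAddEquiv_balancedMap {N N' : Type u} [AddCommGroup N] [Module S N]
    [AddCommGroup N'] [Module S N'] (f : N →ₗ[S] N') (t : BalancedTensor LiftInt.{u} S ω N) :
    balancedTensorAddEquiv R S ω N' (balancedMap LiftInt S ω f t) =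
      balancedMap R S ω f (balancedTensorAddEquiv R S ω N t) := by
  induction t using balancedTensor_induction with
  | zero => simp only [map_zero]
  | tmul x y => rfl
  | add a b ha hb => simp only [map_add, ha, hb]

theorem isZero_leftDerived_injective (hω : IsSemidualizing R S ω) (i : ℕ) (I : ModuleCat.{u} R)
    [Injective I] :
    IsZero (((tensorFunctor R S ω).leftDerived (i + 1)).obj ((homFunctor R S ω).obj I)) := by
  have := SMulCommClass.symm R Sᵐᵒᵖ ω
  have := Module.injective_module_of_injective_object R I
  let P := projectiveResolution ((homFunctor R S ω).obj I)
  obtain ⟨e⟩ := nonempty_leftDerived_iso_homology (tensorFunctor R S ω) P i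
  refine IsZero.of_iso ?_ e
  rw [← ShortComplex.exact_iff_isZero_homology,
    ShortComplex.ShortExact.moduleCat_exact_iff_function_exact]
  have H := balancedMap_exact_of_ext_vanishing P i (hω.finite_right.hasFiniteSyzygies _)
    hω.ext_right
  intro (t : BalancedTensor R S ω _)
  obtain ⟨t, rfl⟩ := (balancedTensorAddEquiv R S ω _).surjective t
  change balancedMap R S ω _ _ = 0 ↔ ∃ t', balancedMap R S ω _ t' = _
  rw [← balancedTensorAddEquiv_balancedMap, EmbeddingLike.map_eq_zero_iff, H t,
    Set.mem_range]
  refine Iff.trans ?_ (balancedTensorAddEquiv R S ω _).surjective.exists.symm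
  refine exists_congr fun t' => ?_
  rw [← balancedTensorAddEquiv_balancedMap, EmbeddingLike.apply_eq_iff_eq]

/-- For `W = ω` the homothety identifies `Hom(ω, ω)` with `R`, and evaluation becomes the counit
followed by `I ≅ Hom_R(R, I)`; this is `key`. -/
theorem isIso_counit_injective (hω : IsSemidualizing R S ω) (I : ModuleCat.{u} R) [Injective I] :
    IsIso ((tensorHomAdjunction R S ω).counit.app I) := by
  have := SMulCommClass.symm R Sᵐᵒᵖ ω
  have := Module.injective_module_of_injective_object R I
  have := (hω.finite_right.hasFiniteSyzygies 0).finite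
  have key : ∀ (t : BalancedTensor LiftInt.{u} S ω (HomModule R ω S I)) (r : R),
      tensorEvaluation t (Module.toModuleEnd Sᵐᵒᵖ ω r : ω →ₗ[Sᵐᵒᵖ] ω) =
        r • balancedUncurry LinearMap.id (balancedTensorAddEquiv R S ω _ t) := by
    intro t r
    induction t using balancedTensor_induction with
    | zero => simp only [map_zero, LinearMap.zero_apply, smul_zero]
    | tmul x φ => exact map_smul φ r x
    | add a b ha hb => simp only [map_add, LinearMap.add_apply, smul_add, ha, hb]
  rw [ConcreteCategory.isIso_iff_bijective, tensorHomAdjunction_counit_app]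
  constructor
  · refine (injective_iff_map_eq_zero (balancedUncurry (R := R) (S := S) (ω := ω)
      (LinearMap.id : HomModule R ω S I →ₗ[S] _))).2 fun t ht => ?_
    obtain ⟨t, rfl⟩ := (balancedTensorAddEquiv R S ω _).surjective t
    obtain ⟨K, Q, f, g, e, -, hg, hQ, -, hK⟩ := hω.finite_right.hasFiniteSyzygies 1
    have : Module.Projective Sᵐᵒᵖ Q := (IsProjective.iff_projective Q).2 hQ
    have := hK.finite
    have hinj := tensorEvaluation_injective (R := R) (ω := ω) (I := I) e.function_exact
      ((ModuleCat.epi_iff_surjective g).1 hg)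
    rw [EmbeddingLike.map_eq_zero_iff]
    apply hinj
    ext v
    obtain ⟨r, rfl⟩ := hω.homothety_left.2 v
    refine (key t r).trans ?_
    rw [ht, smul_zero, map_zero, LinearMap.zero_apply]
  · intro b
    let h : R →ₗ[R] (ω →ₗ[Sᵐᵒᵖ] ω) :=
      { toFun := fun r => Module.toModuleEnd Sᵐᵒᵖ ω r
        map_add' := fun r r' => map_add _ r r'
        map_smul' := fun r r' => map_mul _ r r' }
    let e : R ≃ₗ[R] (ω →ₗ[Sᵐᵒᵖ] ω) := LinearEquiv.ofBijective h hω.homothety_left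
    obtain ⟨t, ht⟩ := tensorEvaluation_surjective (S := S)
      (LinearMap.toSpanSingleton R I b ∘ₗ e.symm.toLinearMap)
    refine ⟨balancedTensorAddEquiv R S ω _ t, ?_⟩
    have h₁ := (key t 1).symm
    rw [one_smul, ht] at h₁
    refine h₁.trans ?_
    change e.symm (e 1) • b = b
    rw [e.symm_apply_apply, one_smul]

end InjectiveAcyclic

/-! ### Strong cogrades as vanishing on all quotients or subobjects, and the conclusion. -/

section StrongCograde

theorem natCast_le_iInf_nontrivial_iff (X : ℕ → Type*) (n : ℕ) :
    (n : ℕ∞) ≤ ⨅ (i : ℕ) (_ : Nontrivial (X i)), (i : ℕ∞) ↔ ∀ j, j < n → Subsingleton (X j) := by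
  simp only [le_iInf_iff, Nat.cast_le]
  refine forall_congr' fun j => ?_
  rw [← not_nontrivial_iff_subsingleton, ← not_le]
  tauto

variable {R S ω : Type u} [Ring R] [Ring S] [AddCommGroup ω] [Module R ω] [Module Sᵐᵒᵖ ω]

theorem isZero_moduleCat_iff {A : Type u} [Ring A] (M : ModuleCat.{u} A) :
    IsZero M ↔ Subsingleton M :=
  ⟨fun h => ModuleCat.subsingleton_of_isZero h, fun _ => ModuleCat.isZero_of_subsingleton M⟩

theorem strongExtCogradeGE_iff [SMulCommClass R Sᵐᵒᵖ ω] (M : ModuleCat.{u} R) (n : ℕ) :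
    StrongExtCogradeGE R ω M n ↔ ∀ (X : ModuleCat.{u} R) (p : M ⟶ X), Epi p → ∀ j, j < n →
      IsZero (extObj R S ω j X) := by
  have h (X : ModuleCat.{u} R) : (n : ℕ∞) ≤ extCograde R ω X ↔
      ∀ j, j < n → IsZero (extObj R S ω j X) := by
    simp only [isZero_moduleCat_iff]
    exact natCast_le_iInf_nontrivial_iff (fun j => Ext.{u} (ModuleCat.of R ω) X j) n
  constructor
  · intro H X p hp j hj
    let e : ModuleCat.of R (M ⧸ LinearMap.ker p.hom) ≅ X :=
      (p.hom.quotKerEquivOfSurjective ((ModuleCat.epi_iff_surjective p).1 hp)).toModuleIso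
    obtain ⟨e'⟩ := (isRightDerivedFamily_ext R S ω).iso j e
    exact ((h _).1 (H _) j hj).of_iso e'.symm
  · intro H K
    exact (h _).2 (H _ (ModuleCat.ofHom K.mkQ) ((ModuleCat.epi_iff_surjective _).2 K.mkQ_surjective))

theorem strongTorCogradeGE_iff (N : ModuleCat.{u} S) (n : ℕ) :
    StrongTorCogradeGE R S ω N n ↔ ∀ (Y : ModuleCat.{u} S) (f : Y ⟶ N), Mono f → ∀ j, j < n →
      IsZero (torObj R S ω j Y) := by
  have h (Y : ModuleCat.{u} S) : (n : ℕ∞) ≤ torCograde R S ω Y ↔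
      ∀ j, j < n → IsZero (torObj R S ω j Y) := by
    simp only [isZero_moduleCat_iff]
    exact natCast_le_iInf_nontrivial_iff (fun j => torObj R S ω j Y) n
  constructor
  · intro H Y f hf j hj
    let e : Y ≅ ModuleCat.of S (LinearMap.range f.hom) :=
      (LinearEquiv.ofInjective f.hom ((ModuleCat.mono_iff_injective f).1 hf)).toModuleIso
    exact ((h _).1 (H _) j hj).of_iso (((tensorFunctor R S ω).leftDerived j).mapIso e)
  · intro H K
    exact (h _).2 (H _ (ModuleCat.ofHom K.subtype)
      ((ModuleCat.mono_iff_injective _).2 K.subtype_injective))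

end StrongCograde

theorem theorem6p9 {R S ω : Type u} [Ring R] [Ring S] [AddCommGroup ω] [Module R ω]
    [Module Sᵐᵒᵖ ω] [SMulCommClass R Sᵐᵒᵖ ω] (hω : IsSemidualizing R S ω)
    (n : ℕ) (hn : 1 ≤ n) :
    (∀ (N : ModuleCat.{u} S) (i : ℕ), 1 ≤ i → i ≤ n →
        StrongExtCogradeGE R ω (torObj R S ω i N) i) ↔
      (∀ (M : ModuleCat.{u} R) (i : ℕ), 1 ≤ i → i ≤ n →
        StrongTorCogradeGE R S ω (extObj R S ω i M) i) := by
  simp only [strongExtCogradeGE_iff (S := S), strongTorCogradeGE_iff]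
  have := (tensorHomAdjunction R S ω).leftAdjoint_preservesColimits
  have : Limits.PreservesFiniteColimits (tensorFunctor R S ω) :=
    Limits.PreservesColimits.preservesFiniteColimits _
  exact cograde_symmetry (tensorHomAdjunction R S ω)
    (isLeftDerivedFamily_leftDerived (tensorFunctor R S ω)) (isRightDerivedFamily_ext R S ω)
    (fun I _ => isIso_counit_injective hω I) (fun i I _ => isZero_leftDerived_injective hω i I)
    (fun P _ => isIso_unit_projective hω P)
    (fun i P _ => (isZero_moduleCat_iff _).2 (subsingleton_ext_tensor_projective hω P i)) n
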